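/- Let $W$ be a finite-dimensional complex vector space, let $\mathrm{Sym}^kW^*$ be the space of symmetric $k$-linear forms on $W$, and for $w\in W$ let $\iota_w:\mathrm{Sym}^{k+1}W^*\to\mathrm{Sym}^kW^*$ be the contraction $(\iota_w\varphi)(w_1,\dots,w_k)=\varphi(w,w_1,\dots,w_k)$. A symbol system of rank $r$ on $W$ is a graded subspace $\mathbf F=\bigoplus_{k\ge 0}F^k\subset\bigoplus_{k\ge0}\mathrm{Sym}^kW^*$ with $F^0=\mathbb C$, $F^1=W^*$, $F^r\ne0$, $F^{r+i}=0$ for all $i\ge1$, and $\iota_w F^{k+1}\subset F^k$ for all $w\in W$ and $1\le k\le r$. Put $\mathbf{Bs}(F^k)=\{[w]\in\mathbb P W:\varphi(w,\dots,w)=0\text{ for all }\varphi\in F^k\}$; the order of $\mathbf F$ is the largest natural number $m$ such that $\mathbf{Bs}(F^m)=\emptyset$. Let $V_{\mathbf F}=\mathbb C\oplus W\oplus(F^2)^*\oplus\cdots\oplus(F^r)^*$, let $\iota_w^k\in(F^k)^*$ be the functional $\varphi\mapsto\varphi(w,\dots,w)$, and let $M(\mathbf F)\subset\mathbb P V_{\mathbf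 F}$ be the proper image (the Zariski closure of the image, with its reduced structure) of the rational map $$\phi_{\mathbf F}:\mathbb P(\mathbb C\oplus W)\dashrightarrow\mathbb P V_{\mathbf F},\qquad [t:w]\mapsto[t^r:t^{r-1}w:t^{r-2}\iota_w^2:\cdots:t\,\iota_w^{r-1}:\iota_w^r].$$ Suppose that the order of $\mathbf F$ is equal to its rank $r$. Then $M(\mathbf F)$ is an integral scheme, and its normalization is isomorphic, over $\mathbb C$, to the projective space $\mathbb P(\mathbb C\oplus W)$. If moreover $M(\mathbf F)$ is nonsingular (smooth over $\mathbb C$), then $M(\mathbf F)$ is a biregular linear projection of the $r$-th Veronese variety: there is a surjective linear map $L:\mathrm{Sym}^r(\mathbb C\oplus W)\to V_{\mathbf F}$ such that the center $\mathbb P(\ker L)$ of the linear projection $[v]\mapsto[Lv]$ does not meet the Veronese variety $\{[u^r]: 0\neq u\in\mathbb C\oplus W\}\subset\mathbb P(\mathrm{Sym}^r(\mathbb C\oplus W))$, and this projection restricts to an isomorphism of the Veronese variety onto $M(\mathbf F)$. -/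

import Mathlib

open CategoryTheory AlgebraicGeometry TopologicalSpace
open scoped LinearAlgebra.Projectivization

noncomputable section

/-! ### Symmetric forms, prolongations and symbol systems -/

/-- `Sym^k W^*`, the space of symmetric `k`-linear forms on `W`. -/
def SymForm (W : Type*) [AddCommGroup W] [Module ℂ W] (k : ℕ) :
    Submodule ℂ (MultilinearMap ℂ (fun _ : Fin k => W) ℂ) where
  carrier := {φ | ∀ (σ : Equiv.Perm (Fin k)) (w : Fin k → W), φ (fun i => w (σ i)) = φ w}
  add_mem' := by
    intro φ ψ hφ hψ σ w
    simp [hφ σ w, hψ σ w]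
  zero_mem' := by
    intro σ w
    simp
  smul_mem' := by
    intro c φ hφ σ w
    simp [hφ σ w]

/-- The contraction `ι_w : Sym^{k+1} W^* → Sym^k W^*`,
`(ι_w φ)(w₁, …, w_k) = φ(w, w₁, …, w_k)`. -/
def contraction {W : Type*} [AddCommGroup W] [Module ℂ W] {k : ℕ} (w : W)
    (φ : SymForm W (k + 1)) : SymForm W k :=
  ⟨φ.1.curryLeft w, by
    intro σ v
    have h := φ.2 (Equiv.Perm.decomposeFin.symm (0, σ)) (Fin.cons w v)
    simp only [MultilinearMap.curryLeft_apply]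
    rw [← h]
    congr 1
    funext i
    refine Fin.cases ?_ (fun j => ?_) i
    · simp
    · simp⟩

/-- The prolongation of a subspace `F ⊆ Sym^k W^*`: all `φ ∈ Sym^{k+1} W^*` such that
`ι_w φ ∈ F` for every `w ∈ W`. -/
def prolongation {W : Type*} [AddCommGroup W] [Module ℂ W] {k : ℕ}
    (F : Submodule ℂ (SymForm W k)) : Submodule ℂ (SymForm W (k + 1)) where
  carrier := {φ | ∀ w : W, contraction w φ ∈ F}
  add_mem' := by
    intro φ ψ hφ hψ w
    exact F.add_mem (hφ w) (hψ w)
  zero_mem' := by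
    intro w
    exact F.zero_mem
  smul_mem' := by
    intro c φ hφ w
    exact F.smul_mem c (hφ w)

/-- A symbol system of rank `r` on the complex vector space `W`. -/
structure SymbolSystem (W : Type*) [AddCommGroup W] [Module ℂ W] (r : ℕ) where
  /-- The homogeneous component `F^k ⊆ Sym^k W^*`. -/
  F : (k : ℕ) → Submodule ℂ (SymForm W k)
  /-- `F^0 = Sym^0 W^* = ℂ`. -/
  F_zero : F 0 = ⊤
  /-- `F^1 = Sym^1 W^* = W^*`. -/
  F_one : F 1 = ⊤
  F_rank : F r ≠ ⊥
  F_above : ∀ i : ℕ, 1 ≤ i → F (r + i) = ⊥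
  F_prolong : ∀ k : ℕ, 1 ≤ k → k ≤ r → F (k + 1) ≤ prolongation (F k)

/-! ### Projective spaces and their closed subvarieties, as schemes over `ℂ` -/

attribute [local instance] MvPolynomial.gradedAlgebra

/-- The projective space `ℙ(V)` of lines in a finite-dimensional complex vector space `V`, as a
scheme: `Proj` of the polynomial ring in the coordinates of `V` (with respect to a fixed basis). -/
abbrev ProjSpace (V : Type*) [AddCommGroup V] [Module ℂ V] [FiniteDimensional ℂ V] : Scheme.{0} :=
  Proj (MvPolynomial.homogeneousSubmodule (Fin (Module.finrank ℂ V)) ℂ)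

/-- The structure morphism `ℙ(V) ⟶ Spec ℂ`. -/
def ProjSpace.str (V : Type*) [AddCommGroup V] [Module ℂ V] [FiniteDimensional ℂ V] :
    ProjSpace V ⟶ Spec (CommRingCat.of ℂ) :=
  Proj.toSpecZero (MvPolynomial.homogeneousSubmodule (Fin (Module.finrank ℂ V)) ℂ) ≫
    Spec.map (CommRingCat.ofHom
      (algebraMap ℂ (MvPolynomial.homogeneousSubmodule (Fin (Module.finrank ℂ V)) ℂ 0)))

/-- Evaluation of a polynomial in the coordinates of `V` at a vector of `V`. -/
def evalAt {V : Type*} [AddCommGroup V] [Module ℂ V] [FiniteDimensional ℂ V] (v : V) :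
    MvPolynomial (Fin (Module.finrank ℂ V)) ℂ →+* ℂ :=
  MvPolynomial.eval (fun i => (Module.finBasis ℂ V).repr v i)

/-- The closed point `[v]` of `ℙ(V)` given by a nonzero vector `v`: its homogeneous prime ideal is
generated by the homogeneous polynomials that vanish at `v`. -/
def ProjSpace.mk {V : Type*} [AddCommGroup V] [Module ℂ V] [FiniteDimensional ℂ V]
    (v : V) (hv : v ≠ 0) : ProjSpace V :=
  show ProjectiveSpectrum (MvPolynomial.homogeneousSubmodule (Fin (Module.finrank ℂ V)) ℂ) from
  { asHomogeneousIdeal := (RingHom.ker (evalAt v)).homogeneousCore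
      (MvPolynomial.homogeneousSubmodule (Fin (Module.finrank ℂ V)) ℂ)
    isPrime := (RingHom.ker_isPrime (evalAt v)).homogeneousCore
    not_irrelevant_le := by
      intro hle
      apply hv
      apply (Module.finBasis ℂ V).repr.map_eq_zero_iff.mp
      ext i
      have hX : (MvPolynomial.X i : MvPolynomial (Fin (Module.finrank ℂ V)) ℂ) ∈
          HomogeneousIdeal.irrelevant
            (MvPolynomial.homogeneousSubmodule (Fin (Module.finrank ℂ V)) ℂ) :=
        HomogeneousIdeal.mem_irrelevant_of_mem _ Nat.one_pos
          (MvPolynomial.isHomogeneous_X ℂ i)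
      have h := Ideal.homogeneousCore'_le _ _ (hle hX)
      simpa [evalAt] using h }

/-- The Zariski closure in `ℙ(V)` of a set of closed points, as a reduced closed subscheme. The set
is given by the nonzero vectors in `S ⊆ V` that represent its points. -/
def closedSubvariety {V : Type*} [AddCommGroup V] [Module ℂ V] [FiniteDimensional ℂ V]
    (S : Set V) : (ProjSpace V).IdealSheafData :=
  Scheme.IdealSheafData.vanishingIdeal
    (Closeds.closure {p : ProjSpace V | ∃ v ∈ S, ∃ hv : v ≠ 0, p = ProjSpace.mk v hv})

/-- The structure morphism to `Spec ℂ` of a closed subscheme of `ℙ(V)`. -/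
def subvarietyStr {V : Type*} [AddCommGroup V] [Module ℂ V] [FiniteDimensional ℂ V]
    (I : (ProjSpace V).IdealSheafData) : I.subscheme ⟶ Spec (CommRingCat.of ℂ) :=
  I.subschemeι ≫ ProjSpace.str V

/-! ### Normalization of an integral scheme -/

instance genericQuasiCompact (X : Scheme.{0}) [IsIntegral X] :
    QuasiCompact (X.fromSpecStalk (genericPoint X)) :=
  have : NoetherianSpace (Spec (X.presheaf.stalk (genericPoint X))) :=
    inferInstanceAs (NoetherianSpace (Spec X.functionField))
  inferInstance

/-- The normalization of an integral scheme `X`: the relative normalization of `X` in the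
spectrum of its function field (the local ring of its generic point). -/
abbrev Normalization (X : Scheme.{0}) [IsIntegral X] : Scheme.{0} :=
  (X.fromSpecStalk (genericPoint X)).normalization

/-- The normalization morphism. -/
abbrev normalizationMap (X : Scheme.{0}) [IsIntegral X] : Normalization X ⟶ X :=
  (X.fromSpecStalk (genericPoint X)).fromNormalization

/-! ### The variety attached to a symbol system -/

namespace SymbolSystem

variable {W : Type*} [AddCommGroup W] [Module ℂ W] {r : ℕ} (F : SymbolSystem W r)

/-- The base locus `Bs(F^k) ⊆ ℙ(W)`. -/
def baseLocus (k : ℕ) : Set (ℙ ℂ W) :=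
  {p | ∀ φ ∈ F.F k, φ.1 (fun _ => p.rep) = 0}

/-- `m` is the order of the symbol system: the largest `m` such that `Bs(F^m)` is empty. -/
def IsOrder (m : ℕ) : Prop :=
  IsGreatest {k : ℕ | F.baseLocus k = ∅} m

/-- `V_F = ℂ ⊕ W ⊕ (F^2)^* ⊕ ⋯ ⊕ (F^r)^*`. -/
abbrev ambient : Type _ :=
  ℂ × W × ((k : Finset.Icc 2 r) → Module.Dual ℂ (F.F k))

/-- The element `ι_w^k` of `(F^k)^*`, i.e. `φ ↦ φ(w, …, w)`. -/
def iotaPow (k : ℕ) (w : W) : Module.Dual ℂ (F.F k) where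
  toFun φ := φ.1.1 (fun _ => w)
  map_add' _ _ := rfl
  map_smul' _ _ := rfl

/-- The homogeneous polynomial map `ℂ ⊕ W → V_F` which defines the rational map `φ_F`,
`(t, w) ↦ (t^r, t^{r-1} w, t^{r-2} ι_w^2, …, t ι_w^{r-1}, ι_w^r)`. -/
def phi (u : ℂ × W) : F.ambient :=
  (u.1 ^ r, u.1 ^ (r - 1) • u.2, fun k => u.1 ^ (r - (k : ℕ)) • F.iotaPow k u.2)

variable [FiniteDimensional ℂ W]

/-- The ideal sheaf on `ℙ(V_F)` of the proper image `M(F)` of the rational map `φ_F`, which is the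
closure of the set of all points `φ_F([t : w])` such that `φ_F` is defined at `[t : w]`. -/
def idealM : (ProjSpace F.ambient).IdealSheafData :=
  closedSubvariety (Set.range F.phi)

/-- The projective variety `M(F) ⊆ ℙ(V_F)`. -/
abbrev M : Scheme.{0} := F.idealM.subscheme

end SymbolSystem

/-! ### The Veronese variety -/

/-- `Sym^r U`, as the dual of the space `Sym^r U^*` of symmetric `r`-linear forms on `U` (`U` is
finite-dimensional over the field `ℂ` of characteristic zero). -/
abbrev SymPow (U : Type*) [AddCommGroup U] [Module ℂ U] (r : ℕ) : Type _ :=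
  Module.Dual ℂ (SymForm U r)

/-- The `r`-th power `u^r ∈ Sym^r U` of a vector `u ∈ U`; its pairing with a symmetric form `φ`
is `φ(u, …, u)`. -/
def symPowOf {U : Type*} [AddCommGroup U] [Module ℂ U] (r : ℕ) (u : U) : SymPow U r where
  toFun φ := φ.1 (fun _ => u)
  map_add' _ _ := rfl
  map_smul' _ _ := rfl

/-- The ideal sheaf on `ℙ(Sym^r U)` of the `r`-th Veronese variety, the image of
`ℙ(U) → ℙ(Sym^r U)`, `[u] ↦ [u^r]`. -/
def idealVeronese (U : Type*) [AddCommGroup U] [Module ℂ U] [FiniteDimensional ℂ U] (r : ℕ) :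
    (ProjSpace (SymPow U r)).IdealSheafData :=
  closedSubvariety (Set.range (symPowOf (U := U) r))

/-- The linear projection `ℙ(V) ⇢ ℙ(V')`, `[v] ↦ [L v]`, given by a surjective linear map
`L : V → V'`, maps the closed subvariety `X ⊆ ℙ(V)` isomorphically onto the closed subvariety
`Y ⊆ ℙ(V')`: there is an isomorphism `e : X ≅ Y` over `ℂ` such that, for every closed point `[v]`
of `X`, the vector `L v` is not zero (the centre of the projection does not meet `X`) and
`e [v] = [L v]`. -/
def ProjectsIsomorphically {V V' : Type*} [AddCommGroup V] [Module ℂ V] [FiniteDimensional ℂ V]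
    [AddCommGroup V'] [Module ℂ V'] [FiniteDimensional ℂ V'] (L : V →ₗ[ℂ] V')
    (X : (ProjSpace V).IdealSheafData) (Y : (ProjSpace V').IdealSheafData) : Prop :=
  ∃ e : X.subscheme ≅ Y.subscheme, e.hom ≫ subvarietyStr Y = subvarietyStr X ∧
    ∀ (x : X.subscheme) (v : V) (hv : v ≠ 0), X.subschemeι x = ProjSpace.mk v hv →
      ∃ hLv : L v ≠ 0, Y.subschemeι (e.hom x) = ProjSpace.mk (L v) hLv

end

noncomputable section

/-! Write `U = ℂ × W`. Since the order equals the rank, `Bs(F^r)` is empty, so `F.phi` vanishes only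
at `0` (`IsOrder.phi_eq_zero`). Its coordinates are forms of degree `r`, so it defines a morphism
`ℙ(U) ⟶ ℙ(V_F)` on the whole space. This morphism is proper and affine, hence finite, and its
scheme-theoretic image is `M(F)` (`closedSubvariety_range`), which is therefore integral.

The map is birational onto its image. Its first two components `t ^ r` and `t ^ (r - 1) • w` recover
all affine coordinates `w / t` where `t ≠ 0`, so it is an isomorphism over a nonempty open subset of
`M(F)` (`exists_isIso_morphismRestrict`). A finite birational morphism from the normal scheme `ℙ(U)`
is the normalization (`exists_normalization_iso`). If `M(F)` is smooth it is itself normal, and a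
finite birational morphism onto a normal scheme is an isomorphism.

For the projection, a form of degree `r` on `U` is a linear form on `Sym^r U` evaluated at `u ^ r`.
Hence `F.phi u = L (u ^ r)` for a linear map `L`. It is surjective because the image of `F.phi`
spans `V_F` (`eq_zero_of_dual_phi_eq_zero`, by polarization). The Veronese map is an isomorphism
onto its image by the chart argument applied to every linear form on `U`, so the projection is a
composite of two isomorphisms. -/

/-! ### Morphisms of `Proj` given by ring homomorphisms that multiply degrees by a constant -/

/-- A ring homomorphism `A → B` of graded rings which multiplies degrees by `r > 0` and such that
the elements of positive degree of `A` have no common zero on `Proj B`. -/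
structure DegreeScalingHom {A B σ τ : Type*} [CommRing A] [SetLike σ A] [AddSubgroupClass σ A]
    [CommRing B] [SetLike τ B] [AddSubgroupClass τ B] (𝒜 : ℕ → σ) (ℬ : ℕ → τ)
    [GradedRing 𝒜] [GradedRing ℬ] (r : ℕ) where
  /-- The underlying ring homomorphism. -/
  hom : A →+* B
  pos : 0 < r
  map_mem' : ∀ {i : ℕ} {a : A}, a ∈ 𝒜 i → hom a ∈ ℬ (i * r)
  not_irrelevant_le : ∀ p : ProjectiveSpectrum ℬ,
    ¬ (HomogeneousIdeal.irrelevant 𝒜).toIdeal ≤ p.asHomogeneousIdeal.toIdeal.comap hom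

namespace DegreeScalingHom

open HomogeneousLocalization (NumDenSameDeg Away AtPrime)
open AlgebraicGeometry.Proj

section

variable {A B σ τ : Type*} [CommRing A] [SetLike σ A] [AddSubgroupClass σ A]
  [CommRing B] [SetLike τ B] [AddSubgroupClass τ B] {𝒜 : ℕ → σ} {ℬ : ℕ → τ}
  [GradedRing 𝒜] [GradedRing ℬ] {r : ℕ} (f : DegreeScalingHom 𝒜 ℬ r)

/-- The map on homogeneous localizations induced by a degree scaling homomorphism, as a function. -/
def mapLocalizationFun {P : Submonoid A} {Q : Submonoid B} (h : P ≤ Q.comap f.hom) :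
    HomogeneousLocalization 𝒜 P → HomogeneousLocalization ℬ Q :=
  Quotient.map'
    (fun x ↦ ⟨x.1 * r, ⟨_, f.map_mem' x.2.2⟩, ⟨_, f.map_mem' x.3.2⟩, h x.4⟩)
    fun x y (e : x.embedding = y.embedding) ↦ by
      apply_fun IsLocalization.map (Localization Q) f.hom h at e
      simp_rw [HomogeneousLocalization.NumDenSameDeg.embedding, Localization.mk_eq_mk',
        IsLocalization.map_mk', ← Localization.mk_eq_mk'] at e
      exact e

lemma val_mapLocalizationFun {P : Submonoid A} {Q : Submonoid B} (h : P ≤ Q.comap f.hom)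
    (x : HomogeneousLocalization 𝒜 P) :
    (f.mapLocalizationFun h x).val = IsLocalization.map (Localization Q) f.hom h x.val := by
  obtain ⟨c, rfl⟩ := HomogeneousLocalization.mk_surjective x
  rw [HomogeneousLocalization.val_mk, Localization.mk_eq_mk', IsLocalization.map_mk',
    ← Localization.mk_eq_mk']
  rfl

/-- The map on homogeneous localizations induced by a degree scaling homomorphism. -/
def mapLocalization {P : Submonoid A} {Q : Submonoid B} (h : P ≤ Q.comap f.hom) :
    HomogeneousLocalization 𝒜 P →+* HomogeneousLocalization ℬ Q where
  toFun := f.mapLocalizationFun h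
  map_add' x y := HomogeneousLocalization.val_injective _ (by simp [val_mapLocalizationFun])
  map_mul' x y := HomogeneousLocalization.val_injective _ (by simp [val_mapLocalizationFun])
  map_zero' := HomogeneousLocalization.val_injective _ (by simp [val_mapLocalizationFun])
  map_one' := HomogeneousLocalization.val_injective _ (by simp [val_mapLocalizationFun])

lemma val_mapLocalization {P : Submonoid A} {Q : Submonoid B} (h : P ≤ Q.comap f.hom)
    (x : HomogeneousLocalization 𝒜 P) :
    (f.mapLocalization h x).val = IsLocalization.map (Localization Q) f.hom h x.val :=
  f.val_mapLocalizationFun h x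

/-- The map `A_(s) → B_(f s)`. -/
def mapAway (s : A) : Away 𝒜 s →+* Away ℬ (f.hom s) :=
  f.mapLocalization (by rintro _ ⟨n, rfl⟩; exact ⟨n, by simp⟩)

lemma mapAway_mk {d : ℕ} {s : A} (hs : s ∈ 𝒜 d) (n : ℕ) (x : A) (hx : x ∈ 𝒜 (n • d)) :
    f.mapAway s (.mk 𝒜 hs n x hx) = .mk ℬ (f.map_mem' hs) n (f.hom x)
      (by simpa [mul_assoc] using f.map_mem' hx) := by
  apply HomogeneousLocalization.val_injective
  simp [mapAway, val_mapLocalization, Localization.mk_eq_mk', IsLocalization.map_mk']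

end

section

universe u

variable {A B σ τ : Type u} [CommRing A] [SetLike σ A] [AddSubgroupClass σ A]
  [CommRing B] [SetLike τ B] [AddSubgroupClass τ B] {𝒜 : ℕ → σ} {ℬ : ℕ → τ}
  [GradedRing 𝒜] [GradedRing ℬ] {r : ℕ} (f : DegreeScalingHom 𝒜 ℬ r)

lemma exists_mem_basicOpen (x : Proj ℬ) :
    ∃ s : Σ i : PNat, 𝒜 i, x ∈ Proj.basicOpen ℬ (f.hom s.2) := by
  by_contra! H
  refine f.not_irrelevant_le x ((HomogeneousIdeal.toIdeal_irrelevant_le _).mpr fun i hi a ha ↦ ?_)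
  simpa using H ⟨⟨i, hi⟩, ⟨a, ha⟩⟩

/-- The affine open cover of `Proj B` by the sets `D₊(f s)`. -/
def affineOpenCover : (Proj ℬ).AffineOpenCover where
  I₀ := Σ i : PNat, 𝒜 i
  X s := .of (Away ℬ (f.hom s.2))
  f s := Proj.awayι ℬ (f.hom s.2) (f.map_mem' s.2.2) (Nat.mul_pos s.1.pos f.pos)
  idx x := (f.exists_mem_basicOpen x).choose
  covers x := by
    change x ∈ (Proj.awayι ℬ _ _ _).opensRange
    rw [Proj.opensRange_awayι]
    exact (f.exists_mem_basicOpen x).choose_spec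

/-- This is the agreement on overlaps needed for gluing. The product is a separate variable `x` so
that both orders of the factors can be used with the same `x`. -/
lemma awayMap_comp_mapAway {d e : ℕ} {s t x : A} (hs : s ∈ 𝒜 d) (ht : t ∈ 𝒜 e) (hx : x = s * t)
    (hx' : f.hom x = f.hom s * f.hom t) :
    (HomogeneousLocalization.awayMap ℬ (f.map_mem' ht) hx').comp (f.mapAway s) =
      (f.mapAway x).comp (HomogeneousLocalization.awayMap 𝒜 ht hx) := by
  ext1 a
  obtain ⟨n, a, ha, rfl⟩ := HomogeneousLocalization.Away.mk_surjective 𝒜 hs a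
  simp only [RingHom.comp_apply, f.mapAway_mk hs, HomogeneousLocalization.awayMap_mk,
    f.mapAway_mk (hx ▸ SetLike.mul_mem_graded hs ht)]
  apply HomogeneousLocalization.val_injective
  simp

lemma specMap_mapAway_awayι_compat {d e : ℕ} {s t x : A} (hs : s ∈ 𝒜 d) (hd : 0 < d)
    (ht : t ∈ 𝒜 e) (hx : x = s * t) (hx' : f.hom x = f.hom s * f.hom t) :
    Spec.map (CommRingCat.ofHom (HomogeneousLocalization.awayMap ℬ (f.map_mem' ht) hx')) ≫
        Spec.map (CommRingCat.ofHom (f.mapAway s)) ≫ Proj.awayι 𝒜 s hs hd =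
      Spec.map (CommRingCat.ofHom (f.mapAway x)) ≫
        Proj.awayι 𝒜 x (hx ▸ SetLike.mul_mem_graded hs ht) (hd.trans_le (d.le_add_right e)) := by
  rw [← Proj.SpecMap_awayMap_awayι 𝒜 hs hd ht hx, ← Category.assoc, ← Category.assoc,
    ← Spec.map_comp, ← Spec.map_comp, ← CommRingCat.ofHom_comp, ← CommRingCat.ofHom_comp,
    awayMap_comp_mapAway f hs ht hx hx']

/-- The morphism `Proj B ⟶ Proj A` induced by a degree scaling homomorphism `A → B`. -/
def projMap : Proj ℬ ⟶ Proj 𝒜 :=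
  f.affineOpenCover.openCover.glueMorphisms
    (fun s ↦ Spec.map (CommRingCat.ofHom (f.mapAway s.2)) ≫ Proj.awayι 𝒜 _ s.2.2 s.1.pos) <| by
    rintro ⟨⟨d, hd⟩, s, hs⟩ ⟨⟨e, he⟩, t, ht⟩
    change Limits.pullback.fst (Proj.awayι ℬ (f.hom s) (f.map_mem' hs) (Nat.mul_pos hd f.pos))
        (Proj.awayι ℬ (f.hom t) (f.map_mem' ht) (Nat.mul_pos he f.pos)) ≫
        Spec.map (CommRingCat.ofHom (f.mapAway s)) ≫ Proj.awayι 𝒜 s hs hd =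
      Limits.pullback.snd _ _ ≫
        Spec.map (CommRingCat.ofHom (f.mapAway t)) ≫ Proj.awayι 𝒜 t ht he
    rw [← cancel_epi (Proj.pullbackAwayιIso ℬ (f.map_mem' hs) (Nat.mul_pos hd f.pos)
      (f.map_mem' ht) (Nat.mul_pos he f.pos) (map_mul f.hom s t)).inv,
      Proj.pullbackAwayιIso_inv_fst_assoc, Proj.pullbackAwayιIso_inv_snd_assoc,
      specMap_mapAway_awayι_compat f hs hd ht rfl,
      specMap_mapAway_awayι_compat f ht he hs (mul_comm s t)]
    rfl

theorem awayι_comp_projMap {i : ℕ} (hi : 0 < i) (s : A) (hs : s ∈ 𝒜 i) :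
    Proj.awayι ℬ (f.hom s) (f.map_mem' hs) (Nat.mul_pos hi f.pos) ≫ f.projMap =
    Spec.map (CommRingCat.ofHom (f.mapAway s)) ≫ Proj.awayι 𝒜 s hs hi :=
  f.affineOpenCover.openCover.ι_glueMorphisms _ _ (⟨⟨i, hi⟩, ⟨s, hs⟩⟩ : Σ i : PNat, 𝒜 i)

/-- The distinguished element of `A_(s)` is `t ^ d / s ^ e`. In `B` the two degrees become `d * r`
and `e * r`, which accounts for the exponent `r`; basic open sets do not see it because `r > 0`. -/
lemma mapAway_isLocalizationElem {d e : ℕ} {s t : A} (hs : s ∈ 𝒜 d) (ht : t ∈ 𝒜 e) :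
    (f.mapAway s (Away.isLocalizationElem hs ht)) ^ r =
      Away.isLocalizationElem (f.map_mem' hs) (f.map_mem' ht) := by
  apply HomogeneousLocalization.val_injective
  rw [f.mapAway_mk hs]
  simp [Localization.mk_pow, pow_mul]

theorem projMap_preimage_basicOpen {i : ℕ} (hi : 0 < i) {t : A} (ht : t ∈ 𝒜 i) :
    f.projMap ⁻¹ᵁ Proj.basicOpen 𝒜 t = Proj.basicOpen ℬ (f.hom t) := by
  have key (s : Σ i : PNat, 𝒜 i) :
      Proj.awayι ℬ (f.hom s.2) (f.map_mem' s.2.2) (Nat.mul_pos s.1.pos f.pos) ⁻¹ᵁ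
        (f.projMap ⁻¹ᵁ Proj.basicOpen 𝒜 t) =
      Proj.awayι ℬ (f.hom s.2) (f.map_mem' s.2.2) (Nat.mul_pos s.1.pos f.pos) ⁻¹ᵁ
        (Proj.basicOpen ℬ (f.hom t)) := by
    rw [← Scheme.Hom.comp_preimage, f.awayι_comp_projMap s.1.pos _ s.2.2, Scheme.Hom.comp_preimage,
      Proj.awayι_preimage_basicOpen 𝒜 s.2.2 s.1.pos ht hi,
      Proj.awayι_preimage_basicOpen ℬ (f.map_mem' s.2.2) _ (f.map_mem' ht) (Nat.mul_pos hi f.pos),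
      ← f.mapAway_isLocalizationElem s.2.2 ht, PrimeSpectrum.basicOpen_pow _ _ f.pos]
    rfl
  ext x
  obtain ⟨s, y, rfl⟩ := f.affineOpenCover.openCover.exists_eq x
  exact SetLike.ext_iff.mp (key s) y

theorem mem_projMap_apply (p : Proj ℬ) {i : ℕ} (hi : 0 < i) {a : A} (ha : a ∈ 𝒜 i) :
    a ∈ (f.projMap p).asHomogeneousIdeal ↔ f.hom a ∈ p.asHomogeneousIdeal := by
  have := SetLike.ext_iff.mp (f.projMap_preimage_basicOpen hi ha) p
  exact not_iff_not.mp this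

/-- The map on components of degree zero. -/
def zeroHom : 𝒜 0 →+* ℬ 0 where
  toFun a := ⟨f.hom a, by simpa using f.map_mem' a.2⟩
  map_one' := by ext; simp
  map_mul' _ _ := by ext; simp
  map_zero' := by ext; simp
  map_add' _ _ := by ext; simp

lemma mapAway_fromZeroRingHom (s : A) (a : 𝒜 0) :
    f.mapAway s (HomogeneousLocalization.fromZeroRingHom 𝒜 _ a) =
      HomogeneousLocalization.fromZeroRingHom ℬ _ (f.zeroHom a) := by
  have h : f.mapAway s (HomogeneousLocalization.mk ⟨0, a, 1, one_mem _⟩) =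
      HomogeneousLocalization.mk ⟨0, f.zeroHom a, 1, one_mem _⟩ := by
    apply HomogeneousLocalization.val_injective
    simp [mapAway, val_mapLocalization, zeroHom, Localization.mk_eq_mk', IsLocalization.map_mk']
  exact h

lemma projMap_toSpecZero :
    f.projMap ≫ Proj.toSpecZero 𝒜 =
      Proj.toSpecZero ℬ ≫ Spec.map (CommRingCat.ofHom f.zeroHom) := by
  refine f.affineOpenCover.openCover.hom_ext _ _ fun (s : Σ i : PNat, 𝒜 i) ↦ ?_
  change Proj.awayι ℬ _ (f.map_mem' s.2.2) (Nat.mul_pos s.1.pos f.pos) ≫ _ =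
    Proj.awayι ℬ _ (f.map_mem' s.2.2) (Nat.mul_pos s.1.pos f.pos) ≫ _
  rw [← Category.assoc, f.awayι_comp_projMap s.1.pos _ s.2.2, Category.assoc,
    Proj.awayι_toSpecZero, Proj.awayι_toSpecZero_assoc, ← Spec.map_comp, ← Spec.map_comp, ← CommRingCat.ofHom_comp,
    ← CommRingCat.ofHom_comp]
  congr 2
  ext a : 1
  exact f.mapAway_fromZeroRingHom _ _

instance : IsAffineHom f.projMap := by
  refine isAffineHom_of_forall_exists_isAffineOpen _ fun x ↦ ?_
  obtain ⟨s, hs⟩ : ∃ s : Σ i : PNat, 𝒜 i, x ∈ Proj.basicOpen 𝒜 s.2.1 := by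
    by_contra! H
    refine x.not_irrelevant_le
      ((HomogeneousIdeal.toIdeal_irrelevant_le _).mpr fun i hi a ha ↦ ?_)
    simpa using H ⟨⟨i, hi⟩, ⟨a, ha⟩⟩
  refine ⟨_, hs, Proj.isAffineOpen_basicOpen 𝒜 _ s.2.2 s.1.pos, ?_⟩
  rw [f.projMap_preimage_basicOpen s.1.pos s.2.2]
  exact Proj.isAffineOpen_basicOpen ℬ _ (f.map_mem' s.2.2) (Nat.mul_pos s.1.pos f.pos)

/-- If `A_(s) → B_(f s)` is surjective then the morphism `Proj B ⟶ Proj A` is a closed immersion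
over `D₊(s)`. -/
lemma isClosedImmersion_morphismRestrict {i : ℕ} (hi : 0 < i) {s : A} (hs : s ∈ 𝒜 i)
    (h : Function.Surjective (f.mapAway s)) :
    IsClosedImmersion (f.projMap ∣_ Proj.basicOpen 𝒜 s) := by
  have h₁ : IsPullback (Spec.map (CommRingCat.ofHom (f.mapAway s)))
      (Proj.awayι ℬ (f.hom s) (f.map_mem' hs) (Nat.mul_pos hi f.pos)) (Proj.awayι 𝒜 s hs hi)
      f.projMap := by
    refine IsOpenImmersion.isPullback _ _ _ _ (f.awayι_comp_projMap hi s hs) ?_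
    rw [Proj.opensRange_awayι, Proj.opensRange_awayι, f.projMap_preimage_basicOpen hi hs]
  have h₂ : IsClosedImmersion (Spec.map (CommRingCat.ofHom (f.mapAway s))) :=
    IsClosedImmersion.spec_of_surjective _ h
  let e := Proj.basicOpenIsoSpec 𝒜 s hs hi
  -- Both `h₁` and `h₄` are pullbacks of `f.projMap` along the same open immersion, so the
  -- restriction is identified with `Spec` of the surjection `f.mapAway s`.
  have h₄ : IsPullback (f.projMap ∣_ Proj.basicOpen 𝒜 s ≫ e.hom)
      (f.projMap ⁻¹ᵁ Proj.basicOpen 𝒜 s).ι (Proj.awayι 𝒜 s hs hi) f.projMap :=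
    (isPullback_morphismRestrict f.projMap (Proj.basicOpen 𝒜 s)).of_iso (Iso.refl _)
      e (Iso.refl _) (Iso.refl _) (by simp) (by simp) (by simp [e, Proj.awayι]) (by simp)
  have h₅ : IsClosedImmersion (f.projMap ∣_ Proj.basicOpen 𝒜 s ≫ e.hom) := by
    have : f.projMap ∣_ Proj.basicOpen 𝒜 s ≫ e.hom =
        (h₄.isoIsPullback _ _ h₁).hom ≫ Spec.map (CommRingCat.ofHom (f.mapAway s)) := by simp
    rw [this]
    infer_instance
  have : f.projMap ∣_ Proj.basicOpen 𝒜 s = (f.projMap ∣_ Proj.basicOpen 𝒜 s ≫ e.hom) ≫ e.inv := by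
    simp
  rw [this]
  infer_instance

end

end DegreeScalingHom

/-! ### Integral morphisms onto normal schemes, and normalizations -/

/-- Inside `K` there are inclusions `A ⊆ B ⊆ K`; every element of `B` is integral over `A`, hence
lies in `A`. -/
lemma bijective_of_isIntegral_of_isIntegrallyClosed {A B K : Type*} [CommRing A] [IsDomain A]
    [IsIntegrallyClosed A] [CommRing B] [Field K] [Algebra A K] [IsFractionRing A K]
    (f : A →+* B) (g : B →+* K) (hf : f.IsIntegral) (hg : Function.Injective g)
    (hfg : g.comp f = algebraMap A K) : Function.Bijective f := by
  refine ⟨fun a b hab ↦ IsFractionRing.injective A K ?_, fun b ↦ ?_⟩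
  · rw [← hfg, RingHom.comp_apply, hab, RingHom.comp_apply]
  · have h : IsIntegral A (g b) := by
      obtain ⟨p, hp, hb⟩ := hf b
      refine ⟨p, hp, ?_⟩
      rw [← hfg, ← Polynomial.hom_eval₂, hb, map_zero]
    obtain ⟨a, ha⟩ := IsIntegrallyClosed.isIntegral_iff.mp h
    refine ⟨a, hg ?_⟩
    rw [← ha, ← hfg, RingHom.comp_apply]

/-- An integral scheme covered by affine open sets whose rings of sections are integrally
closed. -/
def IsCoveredByIntegrallyClosed (X : Scheme.{0}) : Prop :=
  ∀ x : X, ∃ U : X.Opens, x ∈ U ∧ IsAffineOpen U ∧ IsIntegrallyClosed Γ(X, U)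

lemma presheaf_map_injective_of_top_le {X : Scheme.{0}} {V : X.Opens} (h : ⊤ ≤ V) :
    Function.Injective (X.presheaf.map (homOfLE h).op) := by
  obtain rfl := top_le_iff.mp h
  have : homOfLE h = 𝟙 _ := Subsingleton.elim _ _
  rw [this, op_id, CategoryTheory.Functor.map_id]
  exact fun _ _ h ↦ h

/-- The morphism `g` embeds the sections of `Y` in the function field of `X`, so the preceding
algebraic lemma applies over each affine open set with integrally closed sections. The point `x` is
a variable because the generic point of `X` may be given as the image of another point. -/
theorem isIso_of_isIntegralHom {X Y : Scheme.{0}} [IsIntegral X]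
    (hX : IsCoveredByIntegrallyClosed X) (f : Y ⟶ X) [IsIntegralHom f] {x : X}
    (hx : genericPoint X = x)
    (g : Spec (X.presheaf.stalk x) ⟶ Y) (hg : g ≫ f = X.fromSpecStalk x)
    (hinj : ∀ U : Y.Opens, Function.Injective (g.app U)) : IsIso f := by
  subst hx
  refine IsZariskiLocalAtTarget.of_forall_exists_morphismRestrict (P := .isomorphisms _)
    fun x ↦ ?_
  obtain ⟨U, hxU, hU, hcl⟩ := hX x
  refine ⟨U, hxU, (isIso_morphismRestrict_iff_isIso_app f hU).mpr ?_⟩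
  have : Nonempty U := ⟨⟨x, hxU⟩⟩
  have := functionField_isFractionRing_of_isAffineOpen X U hU
  have hη : genericPoint X ∈ U :=
    ((genericPoint_spec X).mem_open_set_iff U.isOpen).mpr ⟨x, by simpa using hxU⟩
  -- All points in the range of `fromSpecStalk` specialize to the generic point, so they lie in
  -- every open set that contains it.
  have htop : ⊤ ≤ g ⁻¹ᵁ f ⁻¹ᵁ U := by
    rintro y -
    rw [← Scheme.Hom.comp_preimage, hg]
    have hy : X.fromSpecStalk (genericPoint X) y ⤳ genericPoint X :=
      (Scheme.range_fromSpecStalk (X := X) (x := genericPoint X)).le ⟨y, rfl⟩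
    exact hy.mem_open U.isOpen hη
  let gK : Γ(Y, f ⁻¹ᵁ U) ⟶ X.presheaf.stalk (genericPoint X) :=
    g.appLE (f ⁻¹ᵁ U) ⊤ htop ≫ (Scheme.ΓSpecIso _).hom
  have hcomp : f.app U ≫ gK = X.presheaf.germ U (genericPoint X) hη := by
    rw [Scheme.Hom.app_eq_appLE, Scheme.Hom.appLE_comp_appLE_assoc]
    simp only [hg]
    rw [Scheme.Hom.appLE, Scheme.fromSpecStalk_app hη]
    simp only [Category.assoc]
    rw [← Functor.map_comp_assoc]
    have h : (Spec (X.presheaf.stalk (genericPoint X))).presheaf.map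
        (homOfLE (le_refl (⊤ : (Spec (X.presheaf.stalk (genericPoint X))).Opens))).op = 𝟙 _ :=
      CategoryTheory.Functor.map_id _ _
    refine (congrArg (fun t ↦ X.presheaf.germ U (genericPoint X) hη ≫
      (Scheme.ΓSpecIso _).inv ≫ t ≫ (Scheme.ΓSpecIso _).hom) h).trans ?_
    simp
  have hgK : Function.Injective gK.hom := by
    simp only [gK, Scheme.Hom.appLE]
    exact ((ConcreteCategory.bijective_of_isIso (Scheme.ΓSpecIso _).hom).1.comp
      (presheaf_map_injective_of_top_le htop)).comp (hinj _)
  rw [ConcreteCategory.isIso_iff_bijective]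
  exact bijective_of_isIntegral_of_isIntegrallyClosed (K := X.functionField) (f.app U).hom gK.hom
    (f.isIntegral_app U hU) hgK congr(($hcomp).hom)

lemma toNormalization_app_injective {X Y : Scheme.{0}} (f : X ⟶ Y) [QuasiCompact f]
    [QuasiSeparated f] (U : f.normalization.Opens) :
    Function.Injective (f.toNormalization.app U) :=
  have : IsSchemeTheoreticallyDominant f.toNormalization := ⟨f.ker_toNormalization⟩
  f.toNormalization.app_injective U

lemma app_injective_of_isIso_comp {X Y Z : Scheme.{0}} (e : X ⟶ Y) [IsIso e] (f : Y ⟶ Z)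
    (hf : ∀ U, Function.Injective (f.app U)) (U : Z.Opens) :
    Function.Injective ((e ≫ f).app U) := by
  rw [Scheme.Hom.comp_app]
  exact (ConcreteCategory.bijective_of_isIso (e.app _)).1.comp (hf U)

lemma fromSpecStalk_app_injective {X : Scheme.{0}} [IsIntegral X] (U : X.Opens) :
    Function.Injective ((X.fromSpecStalk (genericPoint X)).app U) := by
  by_cases hη : genericPoint X ∈ U
  · rw [Scheme.fromSpecStalk_app hη]
    have h : ⊤ ≤ X.fromSpecStalk (genericPoint X) ⁻¹ᵁ U := by
      rintro y -
      have hy : X.fromSpecStalk (genericPoint X) y ⤳ genericPoint X :=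
        (Scheme.range_fromSpecStalk (X := X) (x := genericPoint X)).le ⟨y, rfl⟩
      exact hy.mem_open U.isOpen hη
    have : ∀ V (hV : V ≤ ⊤), ⊤ ≤ V → Function.Injective
        ((Spec (X.presheaf.stalk (genericPoint X))).presheaf.map (homOfLE hV).op) := by
      intro V hV hV'
      obtain rfl := top_le_iff.mp hV'
      exact presheaf_map_injective_of_top_le hV
    exact ((this _ _ h).comp (ConcreteCategory.bijective_of_isIso (Scheme.ΓSpecIso _).inv).1).comp
      (germ_injective_of_isIntegral X _ hη)
  · have : U = ⊥ := by
      ext x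
      simp only [SetLike.mem_coe, Opens.coe_bot, Set.mem_empty_iff_false, iff_false]
      intro hx
      exact hη (((genericPoint_spec X).mem_open_set_iff U.isOpen).mpr ⟨x, by simpa using hx⟩)
    subst this
    exact Function.injective_of_subsingleton _

lemma genericPoint_of_isDominant {X Y : Scheme.{0}} [IrreducibleSpace X] [IrreducibleSpace Y]
    (f : Y ⟶ X) [IsDominant f] : genericPoint X = f (genericPoint Y) := by
  apply (genericPoint_spec X).eq
  have := (genericPoint_spec Y).image f.continuous
  rwa [Set.image_univ, f.denseRange.closure_range] at this

/-- The isomorphism of stalks lets `Spec` of the local ring at `x` factor through `Y`. The universal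
property then gives a morphism from the normalization to `Y`; it is integral, and normality of `Y`
makes it an isomorphism. -/
theorem exists_normalization_iso {X Y : Scheme.{0}} [IsIntegral Y]
    (hY : IsCoveredByIntegrallyClosed Y) (f : Y ⟶ X) [IsIntegralHom f] {x : X}
    (hx : f (genericPoint Y) = x) [IsIso (f.stalkMap (genericPoint Y))]
    [QuasiCompact (X.fromSpecStalk x)] [QuasiSeparated (X.fromSpecStalk x)] :
    ∃ e : (X.fromSpecStalk x).normalization ≅ Y,
      e.hom ≫ f = (X.fromSpecStalk x).fromNormalization := by
  subst hx
  let s := Spec.map (f.stalkMap (genericPoint Y))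
  have H : X.fromSpecStalk (f (genericPoint Y)) = (inv s ≫ Y.fromSpecStalk (genericPoint Y)) ≫ f := by
    rw [Category.assoc, IsIso.eq_inv_comp]
    exact Scheme.SpecMap_stalkMap_fromSpecStalk f
  let d := (X.fromSpecStalk (f (genericPoint Y))).normalizationDesc _ f H
  have : IsIso d := by
    refine isIso_of_isIntegralHom hY d rfl
      (s ≫ (X.fromSpecStalk (f (genericPoint Y))).toNormalization) ?_ ?_
    · simp [d]
    · exact app_injective_of_isIso_comp _ _ (toNormalization_app_injective _)
  exact ⟨asIso d, Scheme.Hom.normalizationDesc_comp _ _ _ H⟩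

theorem isIso_of_isIntegralHom_of_isIso_stalkMap {X Y : Scheme.{0}} [IsIntegral X] [IsIntegral Y]
    (hX : IsCoveredByIntegrallyClosed X) (f : Y ⟶ X) [IsIntegralHom f] [IsDominant f]
    [IsIso (f.stalkMap (genericPoint Y))] : IsIso f := by
  let s := Spec.map (f.stalkMap (genericPoint Y))
  refine isIso_of_isIntegralHom hX f (genericPoint_of_isDominant f)
    (inv s ≫ Y.fromSpecStalk (genericPoint Y)) ?_ ?_
  · rw [Category.assoc, IsIso.inv_comp_eq]
    exact (Scheme.SpecMap_stalkMap_fromSpecStalk f).symm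
  · exact app_injective_of_isIso_comp _ _ fromSpecStalk_app_injective

lemma isIso_stalkMap_of_isIso_morphismRestrict {X Y : Scheme.{0}} (f : Y ⟶ X) (U : X.Opens)
    [IsIso (f ∣_ U)] (y : Y) (hy : f y ∈ U) : IsIso (f.stalkMap y) := by
  have : IsIso (Scheme.Hom.stalkMap (f ∣_ U) (show (f ⁻¹ᵁ U).toScheme from ⟨y, hy⟩)) :=
    inferInstance
  exact (MorphismProperty.arrow_mk_iso_iff (.isomorphisms _)
    (morphismRestrictStalkMap f U ⟨y, hy⟩)).mp this

/-! ### Smooth schemes over a field are normal -/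

open TensorProduct in
-- With `K = Frac R`, the ring `S ⊗ K` is a domain finite over `K`, hence a field, and it is the
-- fraction field of `S`. Integral closure commutes with smooth base change, so the integral closure
-- of `S` in it is `S ⊗ R = S`.
lemma isIntegrallyClosed_of_etale (R S : Type*) [CommRing R] [IsDomain R] [IsIntegrallyClosed R]
    [CommRing S] [IsDomain S] [Algebra R S] [Algebra.Etale R S] : IsIntegrallyClosed S := by
  let K := FractionRing R
  have hinj : Function.Injective (algebraMap R S) := FaithfulSMul.algebraMap_injective R S
  have hloc : IsLocalization (Algebra.algebraMapSubmonoid S (nonZeroDivisors R)) (S ⊗[R] K) :=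
    inferInstance
  have hM : Algebra.algebraMapSubmonoid S (nonZeroDivisors R) ≤ nonZeroDivisors S :=
    algebraMapSubmonoid_le_nonZeroDivisors_of_faithfulSMul _ le_rfl
  have : IsDomain (S ⊗[R] K) := IsLocalization.isDomain_of_le_nonZeroDivisors _ hM
  have : IsDomain (K ⊗[R] S) := (Algebra.TensorProduct.comm R K S).toMulEquiv.isDomain _
  have : Module.Finite K (K ⊗[R] S) := Algebra.FormallyUnramified.finite_of_free K (K ⊗[R] S)
  have hfield : IsField (S ⊗[R] K) :=
    (Algebra.TensorProduct.comm R S K).toMulEquiv.isField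
      (isField_of_isIntegral_of_isField' (R := K) (Semifield.toIsField K))
  let _ : Field (S ⊗[R] K) := hfield.toField
  have : IsFractionRing S (S ⊗[R] K) := by
    refine .of_field _ _ fun z ↦ ?_
    obtain ⟨a, b, rfl⟩ := IsLocalization.exists_mk'_eq
      (Algebra.algebraMapSubmonoid S (nonZeroDivisors R)) z
    refine ⟨a, b, ?_⟩
    rw [eq_div_iff, IsLocalization.mk'_spec]
    exact (IsLocalization.map_units _ b).ne_zero
  refine (isIntegrallyClosed_iff (S ⊗[R] K)).mpr fun {x} hx ↦ ?_
  obtain ⟨y, hy⟩ := (TensorProduct.toIntegralClosure_bijective_of_smooth (R := R) (S := S)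
    (B := K)).2 ⟨x, hx⟩
  obtain rfl : (TensorProduct.toIntegralClosure R S K y : S ⊗[R] K) = x := congr($(hy).1)
  clear hy hx
  induction y with
  | zero => exact ⟨0, by simp⟩
  | add a b ha hb =>
    obtain ⟨a', ha⟩ := ha
    obtain ⟨b', hb⟩ := hb
    exact ⟨a' + b', by simp [ha, hb]⟩
  | tmul s b =>
    obtain ⟨c, hc⟩ := IsIntegrallyClosed.isIntegral_iff.mp b.2
    refine ⟨s * algebraMap R S c, ?_⟩
    simp only [TensorProduct.toIntegralClosure, AlgHom.coe_codRestrict,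
      Algebra.TensorProduct.map_tmul, AlgHom.id_apply, Subalgebra.val_apply, ← hc]
    rw [Algebra.TensorProduct.algebraMap_apply, Algebra.algebraMap_self_apply,
      mul_comm, ← Algebra.smul_def, TensorProduct.smul_tmul, Algebra.smul_def, mul_one]

/-- Locally a smooth scheme over a field is étale over an affine space, whose polynomial ring is
integrally closed. -/
theorem isCoveredByIntegrallyClosed_of_smooth {X : Scheme.{0}} [IsIntegral X] {k : Type} [Field k]
    (f : X ⟶ Spec (CommRingCat.of k)) [Smooth f] : IsCoveredByIntegrallyClosed X := by
  intro x
  obtain ⟨V, hV, hxV, -⟩ := exists_isAffineOpen_mem_and_subset (x := x) (U := ⊤) trivial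
  have : Nonempty V := ⟨⟨x, hxV⟩⟩
  have h₁ := Smooth.smooth_appLE f (isAffineOpen_top _) hV le_top
  let φ : k →+* Γ(X, V) := (f.appLE ⊤ V le_top).hom.comp (Scheme.ΓSpecIso (.of k)).inv.hom
  have hφ : φ.Smooth := by
    refine RingHom.Smooth.comp (.of_bijective ?_) h₁
    exact ConcreteCategory.bijective_of_isIso (Scheme.ΓSpecIso (.of k)).inv
  algebraize [φ]
  let p := hV.primeIdealOf ⟨x, hxV⟩
  obtain ⟨g, hg, n, _, _, _⟩ :=
    Algebra.IsSmoothAt.exists_isStandardEtale_mvPolynomial (R := k) (p := p.asIdeal)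
  have hg0 : g ≠ 0 := by
    rintro rfl
    exact hg (zero_mem _)
  have : IsDomain (Localization.Away g) :=
    IsLocalization.isDomain_of_le_nonZeroDivisors _ (powers_le_nonZeroDivisors_of_noZeroDivisors hg0)
  have := isIntegrallyClosed_of_etale (MvPolynomial (Fin n) k) (Localization.Away g)
  refine ⟨X.basicOpen g, ?_, hV.basicOpen g, ?_⟩
  · have h : p ∈ hV.fromSpec ⁻¹ᵁ X.basicOpen g := by
      rw [hV.fromSpec_preimage_basicOpen]
      exact hg
    have h' : hV.fromSpec p ∈ X.basicOpen g := h
    rwa [hV.fromSpec_primeIdealOf] at h'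
  · have := hV.isLocalization_basicOpen g
    exact .of_equiv (IsLocalization.algEquiv (.powers g) (Localization.Away g)
      Γ(X, X.basicOpen g)).toRingEquiv

attribute [local instance] MvPolynomial.gradedAlgebra

/-! ### `Proj` of a graded integrally closed domain -/

section GradedDomain

open HomogeneousLocalization (Away)

variable {A σ : Type*} [CommRing A] [SetLike σ A] [AddSubgroupClass σ A] (𝒜 : ℕ → σ)
  [GradedRing 𝒜]

lemma isDomain_away [IsDomain A] {s : A} (hs : s ≠ 0) : IsDomain (Away 𝒜 s) :=
  have : IsDomain (Localization.Away s) :=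
    IsLocalization.isDomain_of_le_nonZeroDivisors _
      (powers_le_nonZeroDivisors_of_noZeroDivisors hs)
  Function.Injective.isDomain (algebraMap (Away 𝒜 s) (Localization.Away s))
    (HomogeneousLocalization.val_injective _)

/-- A quotient in `A_s` of two elements of degree zero may be replaced by its component of degree
zero. -/
lemma away_dvd_of_val_dvd [IsDomain A] {d : ℕ} {s : A} (hs : s ∈ 𝒜 d) (hs0 : s ≠ 0)
    (a b : Away 𝒜 s) (h : b.val ∣ a.val) : b ∣ a := by
  obtain ⟨m, α, hα, rfl⟩ := HomogeneousLocalization.Away.mk_surjective 𝒜 hs a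
  obtain ⟨n, β, hβ, rfl⟩ := HomogeneousLocalization.Away.mk_surjective 𝒜 hs b
  obtain ⟨z, hz⟩ := h
  obtain ⟨c, ⟨_, k, rfl⟩, rfl⟩ := IsLocalization.exists_mk'_eq (Submonoid.powers s) z
  simp only [HomogeneousLocalization.Away.val_mk, ← Localization.mk_eq_mk', Localization.mk_mul,
    Localization.mk_eq_mk_iff, Localization.r_iff_exists] at hz
  obtain ⟨⟨_, l, rfl⟩, hc⟩ := hz
  simp only [Submonoid.coe_mul] at hc
  have hc := mul_left_cancel₀ (pow_ne_zero l hs0) hc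
  have hβs : s ^ m * β ∈ 𝒜 (m • d + n • d) :=
    SetLike.mul_mem_graded (SetLike.pow_mem_graded m hs) hβ
  have hαs : s ^ n * s ^ k * α ∈ 𝒜 (n • d + k • d + m • d) :=
    SetLike.mul_mem_graded (SetLike.mul_mem_graded (SetLike.pow_mem_graded n hs)
      (SetLike.pow_mem_graded k hs)) hα
  -- Compare the components of degree `(m + n + k) • d` in `hc`: since `s ^ m * β` is homogeneous,
  -- only the component of `c` of degree `k • d` contributes.
  have key : s ^ n * s ^ k * α = s ^ m * β * DirectSum.decompose 𝒜 c (k • d) := by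
    rw [← DirectSum.coe_decompose_mul_add_of_left_mem 𝒜 hβs, mul_assoc (s ^ m), ← hc]
    rw [show m • d + n • d + k • d = n • d + k • d + m • d by ring]
    exact (DirectSum.decompose_of_mem_same 𝒜 hαs).symm
  refine ⟨.mk 𝒜 hs k _ (SetLike.coe_mem (DirectSum.decompose 𝒜 c (k • d))), ?_⟩
  apply HomogeneousLocalization.val_injective
  simp only [HomogeneousLocalization.val_mul, HomogeneousLocalization.Away.val_mk,
    Localization.mk_mul, Localization.mk_eq_mk_iff, Localization.r_iff_exists]
  refine ⟨1, ?_⟩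
  simp only [Submonoid.coe_mul, OneMemClass.coe_one, one_mul]
  rw [key]
  ring

/-- A fraction `a / b` integral over `A_(s)` is integral over the integrally closed ring `A_s`. So
`b` divides `a` in `A_s`, and then already in `A_(s)`. -/
lemma isIntegrallyClosed_away [IsDomain A] [IsIntegrallyClosed A] {d : ℕ} {s : A} (hs : s ∈ 𝒜 d)
    (hs0 : s ≠ 0) : IsIntegrallyClosed (Away 𝒜 s) := by
  have : IsDomain (Away 𝒜 s) := isDomain_away 𝒜 hs0
  have hM := powers_le_nonZeroDivisors_of_noZeroDivisors hs0
  have : IsDomain (Localization.Away s) := IsLocalization.isDomain_of_le_nonZeroDivisors _ hM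
  have : IsIntegrallyClosed (Localization.Away s) := isIntegrallyClosed_of_isLocalization _ _ hM
  have hj : Function.Injective (algebraMap (Away 𝒜 s) (Localization.Away s)) :=
    HomogeneousLocalization.val_injective _
  let g : FractionRing (Away 𝒜 s) →+* FractionRing (Localization.Away s) := IsFractionRing.map hj
  have hg (a : Away 𝒜 s) : g (algebraMap _ _ a) =
      algebraMap (Localization.Away s) (FractionRing (Localization.Away s)) a.val :=
    IsLocalization.map_eq _ _
  refine (isIntegrallyClosed_iff (FractionRing (Away 𝒜 s))).mpr fun {x} hx ↦ ?_
  have h : IsIntegral (Localization.Away s) (g x) := by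
    obtain ⟨p, hp, hpx⟩ := hx
    refine ⟨p.map (algebraMap _ _), hp.map _, ?_⟩
    have h₁ : (algebraMap (Localization.Away s) (FractionRing (Localization.Away s))).comp
        (algebraMap (Away 𝒜 s) (Localization.Away s)) = g.comp (algebraMap _ _) :=
      RingHom.ext fun a ↦ (hg a).symm
    rw [Polynomial.eval₂_map, h₁, ← Polynomial.hom_eval₂, hpx, map_zero]
  obtain ⟨z, hz⟩ := IsIntegrallyClosed.isIntegral_iff.mp h
  obtain ⟨a, b, hb, rfl⟩ := IsFractionRing.div_surjective (A := Away 𝒜 s) x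
  have hb0 : algebraMap (Away 𝒜 s) (FractionRing (Away 𝒜 s)) b ≠ 0 :=
    (map_ne_zero_iff _ (IsFractionRing.injective _ _)).mpr (nonZeroDivisors.ne_zero hb)
  obtain ⟨c, rfl⟩ := away_dvd_of_val_dvd 𝒜 hs hs0 a b <| by
    refine ⟨z, IsFractionRing.injective _ (FractionRing (Localization.Away s)) ?_⟩
    rw [map_mul, hz, ← hg, ← hg, ← map_mul, mul_div_cancel₀ _ hb0]
  exact ⟨c, by rw [map_mul, mul_div_cancel_left₀ _ hb0]⟩

/-- The zero ideal is a generic point; `s` shows that it does not contain the irrelevant ideal. -/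
lemma irreducibleSpace_proj [IsDomain A] {d : ℕ} (hd : 0 < d) {s : A} (hs : s ∈ 𝒜 d)
    (hs0 : s ≠ 0) : IrreducibleSpace (ProjectiveSpectrum 𝒜) := by
  let η : ProjectiveSpectrum 𝒜 :=
    { asHomogeneousIdeal := ⊥
      isPrime := Ideal.isPrime_bot
      not_irrelevant_le h := hs0 (h (HomogeneousIdeal.mem_irrelevant_of_mem 𝒜 hd hs)) }
  have hη : closure {η} = Set.univ := by
    refine Set.eq_univ_of_forall fun p ↦ ?_
    rw [← ProjectiveSpectrum.le_iff_mem_closure]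
    exact bot_le (a := p.asHomogeneousIdeal)
  rw [irreducibleSpace_def, Set.top_eq_univ, ← hη]
  exact isIrreducible_singleton.closure

end GradedDomain

section GradedDomain

open HomogeneousLocalization (Away)

variable {A σ : Type} [CommRing A] [SetLike σ A] [AddSubgroupClass σ A] (𝒜 : ℕ → σ)
  [GradedRing 𝒜]

lemma exists_mem_basicOpen_of_pos (x : Proj 𝒜) :
    ∃ (d : ℕ) (_ : 0 < d) (s : A) (_ : s ∈ 𝒜 d) (_ : s ≠ 0), x ∈ Proj.basicOpen 𝒜 s := by
  by_contra! H
  refine x.not_irrelevant_le ((HomogeneousIdeal.toIdeal_irrelevant_le _).mpr fun i hi a ha ↦ ?_)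
  by_cases ha0 : a = 0
  · rw [ha0]
    exact zero_mem _
  · simpa using H i hi a ha ha0

lemma isReduced_proj [IsDomain A] : IsReduced (Proj 𝒜) := by
  have (j : Σ i : PNat, 𝒜 i) : IsReduced ((Proj.affineOpenCover 𝒜).openCover.X j) := by
    change IsReduced (Spec (CommRingCat.of (Away 𝒜 (j.2 : A))))
    have : _root_.IsReduced (Localization.Away (j.2 : A)) :=
      isReduced_localizationPreserves (.powers (j.2 : A)) _ inferInstance
    have : _root_.IsReduced (Away 𝒜 (j.2 : A)) :=
      isReduced_of_injective (algebraMap (Away 𝒜 (j.2 : A)) (Localization.Away (j.2 : A)))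
        (HomogeneousLocalization.val_injective _)
    infer_instance
  have (j : (Proj.affineOpenCover 𝒜).openCover.I₀) :
      IsReduced ((Proj.affineOpenCover 𝒜).openCover.X j) := this j
  exact IsReduced.of_openCover _ (Proj.affineOpenCover 𝒜).openCover

lemma isIntegral_proj [IsDomain A] {d : ℕ} (hd : 0 < d) {s : A} (hs : s ∈ 𝒜 d) (hs0 : s ≠ 0) :
    IsIntegral (Proj 𝒜) := by
  have := isReduced_proj 𝒜
  have : IrreducibleSpace (Proj 𝒜) := irreducibleSpace_proj 𝒜 hd hs hs0
  exact isIntegral_of_irreducibleSpace_of_isReduced _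

lemma isCoveredByIntegrallyClosed_proj [IsDomain A] [IsIntegrallyClosed A] :
    IsCoveredByIntegrallyClosed (Proj 𝒜) := by
  intro x
  obtain ⟨d, hd, s, hs, hs0, hx⟩ := exists_mem_basicOpen_of_pos 𝒜 x
  refine ⟨_, hx, Proj.isAffineOpen_basicOpen 𝒜 s hs hd, ?_⟩
  have := isIntegrallyClosed_away 𝒜 hs hs0
  exact .of_equiv (Proj.basicOpenIsoAway 𝒜 s hs hd).commRingCatIsoToRingEquiv

/-- Membership in degree zero is recovered after multiplication by an element of positive degree
outside the prime. The restriction matters because `mem_projMap_apply` only covers positive degrees.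
-/
lemma projectiveSpectrum_ext {p q : ProjectiveSpectrum 𝒜}
    (h : ∀ (d : ℕ) (_ : 0 < d) (s : A), s ∈ 𝒜 d →
      (s ∈ p.asHomogeneousIdeal ↔ s ∈ q.asHomogeneousIdeal)) : p = q := by
  have key : ∀ {p q : ProjectiveSpectrum 𝒜} (_ : ∀ (d : ℕ) (_ : 0 < d) (s : A), s ∈ 𝒜 d →
      (s ∈ p.asHomogeneousIdeal ↔ s ∈ q.asHomogeneousIdeal)),
      p.asHomogeneousIdeal ≤ q.asHomogeneousIdeal := by
    intro p q h
    obtain ⟨e, he, t, ht, -, hpt⟩ := exists_mem_basicOpen_of_pos 𝒜 q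
    refine fun a ha ↦
      (Ideal.IsHomogeneous.mem_iff 𝒜 q.asHomogeneousIdeal.isHomogeneous).mpr fun i ↦ ?_
    have h₁ : (DirectSum.decompose 𝒜 a i : A) * t ∈ q.asHomogeneousIdeal :=
      (h (i + e) (by omega) _ (SetLike.mul_mem_graded (SetLike.coe_mem _) ht)).mp
        (Ideal.mul_mem_right _ _ (p.asHomogeneousIdeal.isHomogeneous i ha))
    exact (q.isPrime.mem_or_mem h₁).resolve_right hpt
  exact ProjectiveSpectrum.ext (le_antisymm (key h) (key fun d hd s hs ↦ (h d hd s hs).symm))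

end GradedDomain

/-! ### Projective spaces -/

namespace ProjSpace

open MvPolynomial (homogeneousSubmodule)

/-- The coordinate ring of `V`. -/
abbrev CoordRing (V : Type*) [AddCommGroup V] [Module ℂ V] : Type :=
  MvPolynomial (Fin (Module.finrank ℂ V)) ℂ

/-- The grading of the coordinate ring of `V`. -/
abbrev grading (V : Type*) [AddCommGroup V] [Module ℂ V] :
    ℕ → Submodule ℂ (CoordRing V) :=
  homogeneousSubmodule (Fin (Module.finrank ℂ V)) ℂ

lemma bijective_algebraMap_grading_zero (V : Type*) [AddCommGroup V] [Module ℂ V] : Function.Bijective (algebraMap ℂ (grading V 0)) := by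
  refine ⟨fun c d h ↦ MvPolynomial.C_injective _ _ congr($(h).1), fun ⟨a, ha⟩ ↦ ?_⟩
  obtain ⟨c, rfl⟩ : ∃ c, MvPolynomial.C c = a := by
    simpa [MvPolynomial.homogeneousSubmodule_zero, Submodule.mem_one] using ha
  exact ⟨c, rfl⟩

variable {V : Type*} [AddCommGroup V] [Module ℂ V] [FiniteDimensional ℂ V]

/-- The vector with given coordinates. -/
def ofCoords (x : Fin (Module.finrank ℂ V) → ℂ) : V :=
  (Module.finBasis ℂ V).equivFun.symm x

lemma evalAt_ofCoords (x : Fin (Module.finrank ℂ V) → ℂ) (a : CoordRing V) :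
    evalAt (ofCoords (V := V) x) a = MvPolynomial.eval x a := by
  have : (fun i ↦ (Module.finBasis ℂ V).repr (ofCoords (V := V) x) i) = x := by
    rw [ofCoords]
    exact (Module.finBasis ℂ V).equivFun.apply_symm_apply x
  rw [evalAt, this]

lemma evalAt_X (v : V) (i) : evalAt v (MvPolynomial.X i) = (Module.finBasis ℂ V).repr v i := by
  simp [evalAt]

lemma evalAt_C (v : V) (c : ℂ) : evalAt v (MvPolynomial.C c) = c := by
  simp [evalAt]

/-- The linear form on `V` attached to an element of the dual space. -/
def linearForm (l : Module.Dual ℂ V) : CoordRing V :=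
  ∑ i, MvPolynomial.C (l (Module.finBasis ℂ V i)) * MvPolynomial.X i

lemma linearForm_mem (l : Module.Dual ℂ V) : linearForm l ∈ grading V 1 :=
  MvPolynomial.IsHomogeneous.sum _ _ _ fun i _ ↦ by
    simpa using (MvPolynomial.isHomogeneous_C _ (l (Module.finBasis ℂ V i))).mul
      (MvPolynomial.isHomogeneous_X ℂ i)

lemma evalAt_linearForm (l : Module.Dual ℂ V) (v : V) : evalAt v (linearForm l) = l v := by
  conv_rhs => rw [← (Module.finBasis ℂ V).sum_repr v, map_sum]
  simp only [linearForm, map_sum, map_mul, evalAt_X, evalAt_C, map_smul, smul_eq_mul, mul_comm]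

lemma evalAt_smul {d : ℕ} {a : CoordRing V} (ha : a ∈ grading V d) (c : ℂ) (v : V) :
    evalAt (c • v) a = c ^ d * evalAt v a := by
  rw [evalAt, evalAt, MvPolynomial.eval_eq', MvPolynomial.eval_eq', Finset.mul_sum]
  refine Finset.sum_congr rfl fun m hm ↦ ?_
  have hd : ∑ i, m i = d := by
    rw [← Finsupp.degree_eq_sum, Finsupp.degree_eq_weight_one]
    exact ha (MvPolynomial.mem_support_iff.mp hm)
  simp only [map_smul, Finsupp.smul_apply, smul_eq_mul, mul_pow, Finset.prod_mul_distrib,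
    Finset.prod_pow_eq_pow_sum, hd]
  ring

lemma coordRing_ext {a b : CoordRing V} (h : ∀ v : V, evalAt v a = evalAt v b) : a = b :=
  MvPolynomial.funext fun x ↦ by simpa [evalAt_ofCoords] using h (ofCoords x)

lemma linearForm_ne_zero {l : Module.Dual ℂ V} (hl : l ≠ 0) : linearForm l ≠ 0 := by
  rintro h
  exact hl (LinearMap.ext fun v ↦ by simp [← evalAt_linearForm, h])

lemma exists_linearForm_ne_zero [Nontrivial V] : ∃ l : Module.Dual ℂ V, linearForm l ≠ 0 := by
  obtain ⟨v, hv⟩ := exists_ne (0 : V)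
  obtain ⟨l, hl⟩ : ∃ l : Module.Dual ℂ V, l v ≠ 0 := by
    by_contra! H
    exact hv ((Module.forall_dual_apply_eq_zero_iff ℂ v).mp H)
  refine ⟨l, linearForm_ne_zero ?_⟩
  rintro rfl
  exact hl rfl

lemma linearForm_coord (i : Fin (Module.finrank ℂ V)) :
    linearForm ((Module.finBasis ℂ V).coord i) = MvPolynomial.X i :=
  coordRing_ext fun v ↦ by rw [evalAt_linearForm, evalAt_X, Module.Basis.coord_apply]

instance [Nontrivial V] : IsIntegral (ProjSpace V) := by
  obtain ⟨l, hl⟩ := exists_linearForm_ne_zero (V := V)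
  exact isIntegral_proj _ one_pos (linearForm_mem l) hl

variable (V) in
lemma isCoveredByIntegrallyClosed : IsCoveredByIntegrallyClosed (ProjSpace V) :=
  isCoveredByIntegrallyClosed_proj _

lemma mem_mk_iff {v : V} (hv : v ≠ 0) {d : ℕ} {a : CoordRing V} (ha : a ∈ grading V d) :
    a ∈ (ProjSpace.mk v hv).asHomogeneousIdeal ↔ evalAt v a = 0 := by
  refine ⟨fun h ↦ Ideal.homogeneousCore'_le _ _ h, fun h ↦ ?_⟩
  exact Ideal.mem_homogeneousCore_of_homogeneous_of_mem ⟨d, ha⟩ h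

lemma ext_point {p q : ProjSpace V} (h : ∀ (d : ℕ) (_ : 0 < d) (a : CoordRing V), a ∈ grading V d →
    (a ∈ p.asHomogeneousIdeal ↔ a ∈ q.asHomogeneousIdeal)) : p = q :=
  projectiveSpectrum_ext _ h

lemma specializes_iff (p q : ProjSpace V) :
    p ⤳ q ↔ p.asHomogeneousIdeal ≤ q.asHomogeneousIdeal := by
  rw [specializes_iff_mem_closure]
  exact (ProjectiveSpectrum.le_iff_mem_closure _ p q).symm

lemma specializes_of_forall {p q : ProjSpace V} (h : ∀ (d : ℕ) (a : CoordRing V), a ∈ grading V d →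
    a ∈ p.asHomogeneousIdeal → a ∈ q.asHomogeneousIdeal) : p ⤳ q := by
  rw [specializes_iff]
  intro a ha
  exact (Ideal.IsHomogeneous.mem_iff _ q.asHomogeneousIdeal.isHomogeneous).mpr fun i ↦
    h i _ (SetLike.coe_mem _) (p.asHomogeneousIdeal.isHomogeneous i ha)

lemma exists_linearForm_notMem (p : ProjSpace V) :
    ∃ l : Module.Dual ℂ V, linearForm l ∉ p.asHomogeneousIdeal := by
  by_contra! H
  refine p.not_irrelevant_le ((HomogeneousIdeal.toIdeal_irrelevant_le _).mpr fun d hd a ha ↦ ?_)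
  have h : a ∈ Ideal.span (MvPolynomial.X '' Set.univ) := by
    refine MvPolynomial.mem_ideal_span_X_image.mpr fun m hm ↦ ?_
    by_contra! H'
    have hm0 : m = 0 := Finsupp.ext fun i ↦ H' i trivial
    have := ha (MvPolynomial.mem_support_iff.mp hm)
    simp [hm0] at this
    omega
  refine Ideal.span_le.mpr ?_ h
  rintro _ ⟨i, -, rfl⟩
  exact linearForm_coord i ▸ H _

/-- By the Nullstellensatz, a linear form outside `p` is nonzero at some common zero of `p`; this
zero is then a nonzero vector. -/
lemma exists_specializes_mk (p : ProjSpace V) : ∃ (v : V) (hv : v ≠ 0), p ⤳ ProjSpace.mk v hv := by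
  obtain ⟨l, hl⟩ := exists_linearForm_notMem p
  have h₁ : linearForm l ∉ MvPolynomial.vanishingIdeal ℂ
      (MvPolynomial.zeroLocus ℂ p.asHomogeneousIdeal.toIdeal) := by
    rw [MvPolynomial.vanishingIdeal_zeroLocus_eq_radical, p.isPrime.radical]
    exact hl
  obtain ⟨x, hx, hlx⟩ : ∃ x ∈ MvPolynomial.zeroLocus ℂ p.asHomogeneousIdeal.toIdeal,
      MvPolynomial.eval x (linearForm l) ≠ 0 := by
    by_contra! H
    exact h₁ fun x hx ↦ by simpa [MvPolynomial.aeval_eq_eval] using H x hx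
  rw [← evalAt_ofCoords, evalAt_linearForm] at hlx
  have hv : ofCoords (V := V) x ≠ 0 := by
    intro h
    simp [h] at hlx
  refine ⟨ofCoords x, hv, specializes_of_forall fun d a ha hap ↦ (mem_mk_iff hv ha).mpr ?_⟩
  rw [evalAt_ofCoords]
  simpa [MvPolynomial.aeval_eq_eval] using hx a hap

/-- Every linear form that vanishes at `v` vanishes at `w`, which puts `w` on the line of `v`. -/
lemma exists_eq_smul_of_specializes {v w : V} {hv : v ≠ 0} {hw : w ≠ 0}
    (h : ProjSpace.mk v hv ⤳ ProjSpace.mk w hw) : ∃ c : ℂ, c ≠ 0 ∧ w = c • v := by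
  have key (l : Module.Dual ℂ V) (hl : l v = 0) : l w = 0 := by
    rw [← evalAt_linearForm, ← mem_mk_iff hw (linearForm_mem l)]
    refine (specializes_iff _ _).mp h ?_
    rwa [mem_mk_iff hv (linearForm_mem l), evalAt_linearForm]
  have hmem : w ∈ Submodule.span ℂ {v} := by
    by_contra H
    obtain ⟨l, hl, hl'⟩ := Submodule.exists_le_ker_of_notMem H
    exact hl (key l (hl' (Submodule.mem_span_singleton_self v)))
  obtain ⟨c, rfl⟩ := Submodule.mem_span_singleton.mp hmem
  refine ⟨c, ?_, rfl⟩
  rintro rfl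
  simp at hw

lemma mk_smul {v : V} (hv : v ≠ 0) {c : ℂ} (hcv : c • v ≠ 0) :
    ProjSpace.mk (c • v) hcv = ProjSpace.mk v hv := by
  refine ext_point fun d hd a ha ↦ ?_
  have hc : c ≠ 0 := by
    rintro rfl
    simp at hcv
  rw [mem_mk_iff hcv ha, mem_mk_iff hv ha, evalAt_smul ha]
  simp [hc]

lemma eq_of_mk_specializes {v : V} {hv : v ≠ 0} {q : ProjSpace V} (h : ProjSpace.mk v hv ⤳ q) :
    q = ProjSpace.mk v hv := by
  obtain ⟨w, hw, hq⟩ := exists_specializes_mk q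
  obtain ⟨c, hc, rfl⟩ := exists_eq_smul_of_specializes (h.trans hq)
  rw [mk_smul hv hw] at hq
  exact (hq.antisymm h).eq

variable (V) in
lemma dense_range_mk :
    Dense {p : ProjSpace V | ∃ (v : V) (hv : v ≠ 0), p = ProjSpace.mk v hv} := by
  refine (ProjectiveSpectrum.isTopologicalBasis_basic_opens (grading V)).dense_iff.mpr ?_
  rintro _ ⟨a, rfl⟩ ⟨p, hp⟩
  obtain ⟨i, hi⟩ : ∃ i, (DirectSum.decompose (grading V) a i : CoordRing V) ∉
      p.asHomogeneousIdeal := by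
    by_contra! H
    exact hp ((Ideal.IsHomogeneous.mem_iff _ p.asHomogeneousIdeal.isHomogeneous).mpr H)
  obtain ⟨l, hl⟩ := exists_linearForm_notMem p
  -- The linear factor forces `v ≠ 0` even when the component has degree zero.
  obtain ⟨v, hv⟩ : ∃ v : V, evalAt v (DirectSum.decompose (grading V) a i * linearForm l) ≠ 0 := by
    by_contra! H
    have h0 : (DirectSum.decompose (grading V) a i * linearForm l : CoordRing V) = 0 :=
      coordRing_ext fun v ↦ by rw [H v, map_zero]
    rcases mul_eq_zero.mp h0 with h | h
    · exact hi (h ▸ zero_mem _)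
    · exact hl (h ▸ zero_mem _)
  rw [map_mul, mul_ne_zero_iff, evalAt_linearForm] at hv
  have hv0 : v ≠ 0 := by
    rintro rfl
    simp at hv
  refine ⟨ProjSpace.mk v hv0, fun h ↦ hv.1 ?_, v, hv0, rfl⟩
  rw [← mem_mk_iff hv0 (SetLike.coe_mem _)]
  exact (ProjSpace.mk v hv0).asHomogeneousIdeal.isHomogeneous i h

instance : IsIso (Spec.map (CommRingCat.ofHom (algebraMap ℂ (grading V 0)))) := by
  have : IsIso (CommRingCat.ofHom (algebraMap ℂ (grading V 0))) :=
    (ConcreteCategory.isIso_iff_bijective _).mpr (bijective_algebraMap_grading_zero V)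
  infer_instance

instance : IsProper (ProjSpace.str V) := by
  have : IsScalarTower ℂ (grading V 0) (CoordRing V) :=
    IsScalarTower.of_algebraMap_eq (R := ℂ) (S := grading V 0) (A := CoordRing V) fun _ ↦ rfl
  have : Algebra.FiniteType (grading V 0) (CoordRing V) :=
    .of_restrictScalars_finiteType ℂ _ _
  have : IsProper (Proj.toSpecZero (grading V)) := inferInstance
  rw [ProjSpace.str]
  infer_instance

end ProjSpace

/-! ### Morphisms of projective spaces given by homogeneous polynomial maps -/

open ProjSpace

/-- A homogeneous polynomial map of degree `r > 0` between finite-dimensional vector spaces which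
has no nontrivial zero. -/
structure HomogeneousMap (U V : Type*) [AddCommGroup U] [Module ℂ U] [FiniteDimensional ℂ U]
    [AddCommGroup V] [Module ℂ V] [FiniteDimensional ℂ V] (r : ℕ) where
  /-- The underlying function. -/
  toFun : U → V
  /-- The polynomials which give the coordinates of the map. -/
  poly : Fin (Module.finrank ℂ V) → CoordRing U
  pos : 0 < r
  poly_mem : ∀ i, poly i ∈ grading U r
  evalAt_poly : ∀ i u, evalAt u (poly i) = (Module.finBasis ℂ V).repr (toFun u) i
  eq_zero : ∀ u, toFun u = 0 → u = 0

namespace HomogeneousMap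

variable {U V : Type*} [AddCommGroup U] [Module ℂ U] [FiniteDimensional ℂ U]
  [AddCommGroup V] [Module ℂ V] [FiniteDimensional ℂ V] {r : ℕ} (Φ : HomogeneousMap U V r)

/-- The homomorphism of coordinate rings. -/
def pullback : CoordRing V →ₐ[ℂ] CoordRing U := MvPolynomial.aeval Φ.poly

lemma evalAt_pullback (u : U) (a : CoordRing V) :
    evalAt u (Φ.pullback a) = evalAt (Φ.toFun u) a := by
  induction a using MvPolynomial.induction_on with
  | C c =>
    rw [← MvPolynomial.algebraMap_eq, AlgHom.commutes, MvPolynomial.algebraMap_eq, evalAt_C,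
      MvPolynomial.algebraMap_eq, evalAt_C]
  | add a b ha hb => simp only [map_add, ha, hb]
  | mul_X a i ha =>
    rw [map_mul, map_mul, ha, map_mul, evalAt_X, pullback, MvPolynomial.aeval_X, Φ.evalAt_poly]

lemma pullback_mem {i : ℕ} {a : CoordRing V} (ha : a ∈ grading V i) :
    Φ.pullback a ∈ grading U (i * r) := by
  rw [mul_comm]
  exact MvPolynomial.IsHomogeneous.aeval ha _ Φ.poly_mem

lemma evalAt_aeval_linearForm {σ : Type*} (lam : σ → Module.Dual ℂ V) (a : MvPolynomial σ ℂ)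
    (v : V) : evalAt v (MvPolynomial.aeval (fun i ↦ linearForm (lam i)) a) =
      MvPolynomial.eval (fun i ↦ lam i v) a := by
  induction a using MvPolynomial.induction_on with
  | C c => rw [MvPolynomial.aeval_C, MvPolynomial.algebraMap_eq, evalAt_C, MvPolynomial.eval_C]
  | add a b ha hb => simp only [map_add, ha, hb]
  | mul_X a i ha => simp only [map_mul, ha, MvPolynomial.aeval_X, evalAt_linearForm,
      MvPolynomial.eval_X]

/-- The homomorphism of graded rings. -/
def gradedHom : DegreeScalingHom (grading V) (grading U) r where
  hom := Φ.pullback.toRingHom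
  pos := Φ.pos
  map_mem' := Φ.pullback_mem
  not_irrelevant_le p h := by
    obtain ⟨u, hu, hp⟩ := exists_specializes_mk p
    refine hu (Φ.eq_zero u ((Module.finBasis ℂ V).repr.map_eq_zero_iff.mp (Finsupp.ext fun i ↦ ?_)))
    have hX : (MvPolynomial.X i : CoordRing V) ∈ HomogeneousIdeal.irrelevant (grading V) :=
      HomogeneousIdeal.mem_irrelevant_of_mem _ one_pos (MvPolynomial.isHomogeneous_X ℂ i)
    have h₁ : Φ.pullback (MvPolynomial.X i) ∈ (ProjSpace.mk u hu).asHomogeneousIdeal :=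
      (specializes_iff _ _).mp hp (h hX)
    rwa [mem_mk_iff hu (Φ.pullback_mem (MvPolynomial.isHomogeneous_X ℂ i)), evalAt_pullback,
      evalAt_X] at h₁

/-- The morphism of projective spaces. -/
def morphism : ProjSpace U ⟶ ProjSpace V := Φ.gradedHom.projMap

lemma toFun_zero : Φ.toFun 0 = 0 := by
  refine (Module.finBasis ℂ V).repr.map_eq_zero_iff.mp (Finsupp.ext fun i ↦ ?_)
  rw [← Φ.evalAt_poly, ← zero_smul ℂ (0 : U), evalAt_smul (Φ.poly_mem i), zero_pow Φ.pos.ne',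
    zero_mul, Finsupp.zero_apply]

lemma toFun_ne_zero {u : U} (hu : u ≠ 0) : Φ.toFun u ≠ 0 := fun h ↦ hu (Φ.eq_zero u h)

lemma morphism_mk {u : U} (hu : u ≠ 0) :
    Φ.morphism (ProjSpace.mk u hu) = ProjSpace.mk (Φ.toFun u) (Φ.toFun_ne_zero hu) := by
  refine ext_point fun d hd a ha ↦ ?_
  rw [mem_mk_iff _ ha, ← evalAt_pullback, ← mem_mk_iff hu (Φ.pullback_mem ha)]
  exact Φ.gradedHom.mem_projMap_apply _ hd ha

lemma morphism_str : Φ.morphism ≫ ProjSpace.str V = ProjSpace.str U := by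
  rw [ProjSpace.str, ← Category.assoc, morphism, DegreeScalingHom.projMap_toSpecZero,
    Category.assoc, ← Spec.map_comp, ← CommRingCat.ofHom_comp]
  congr 3
  ext c : 2
  exact Φ.pullback.commutes c

instance : IsIntegralHom Φ.morphism := by
  have h₁ : IsProper (Φ.morphism ≫ ProjSpace.str V) := by
    rw [morphism_str]
    infer_instance
  have h₂ : IsProper Φ.morphism := .of_comp _ (ProjSpace.str V)
  have h₃ : IsAffineHom Φ.morphism := inferInstanceAs (IsAffineHom Φ.gradedHom.projMap)
  have : IsFinite Φ.morphism := IsFinite.iff_isProper_and_isAffineHom.mpr ⟨h₂, h₃⟩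
  infer_instance

/-- The points `[u]` are dense in `ℙ(U)`, so their images have the same closure as the whole range.
The kernel is radical because `ℙ(U)` is reduced, so the reduced closure is the scheme-theoretic
image. -/
lemma closedSubvariety_range [Nontrivial U] :
    closedSubvariety (Set.range Φ.toFun) = Φ.morphism.ker := by
  have h₁ : Φ.morphism.ker.radical = Φ.morphism.ker := by
    ext W : 2
    rw [Scheme.IdealSheafData.radical_ideal, Scheme.Hom.ker_apply]
    exact ((Ideal.isRadical_bot (R := Γ(ProjSpace U, Φ.morphism ⁻¹ᵁ W))).comap _).radical
  rw [closedSubvariety, ← h₁, ← Scheme.IdealSheafData.vanishingIdeal_support]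
  congr 1
  ext1
  rw [Scheme.Hom.support_ker]
  have h₂ : {p : ProjSpace V | ∃ v ∈ Set.range Φ.toFun, ∃ hv : v ≠ 0, p = ProjSpace.mk v hv} =
      Φ.morphism '' {p | ∃ (u : U) (hu : u ≠ 0), p = ProjSpace.mk u hu} := by
    ext p
    constructor
    · rintro ⟨_, ⟨u, rfl⟩, hv, rfl⟩
      have hu : u ≠ 0 := by
        rintro rfl
        exact hv Φ.toFun_zero
      exact ⟨_, ⟨u, hu, rfl⟩, Φ.morphism_mk hu⟩
    · rintro ⟨_, ⟨u, hu, rfl⟩, rfl⟩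
      exact ⟨_, ⟨u, rfl⟩, _, Φ.morphism_mk hu⟩
  rw [h₂]
  refine subset_antisymm (closure_mono (Set.image_subset_range _ _)) ?_
  refine closure_minimal ?_ isClosed_closure
  rw [← Set.image_univ, ← (dense_range_mk U).closure_eq]
  exact image_closure_subset_closure_image Φ.morphism.continuous

/-! ### The image variety and its parametrization -/

/-- The subvariety of `ℙ(V)` parametrized by a homogeneous polynomial map. -/
abbrev image : Scheme.{0} := (closedSubvariety (Set.range Φ.toFun)).subscheme

/-- The embedding of the subvariety parametrized by a homogeneous polynomial map. -/
abbrev imageι : Φ.image ⟶ ProjSpace V := (closedSubvariety (Set.range Φ.toFun)).subschemeι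

variable [Nontrivial U]

lemma exists_toImage : ∃ g : ProjSpace U ⟶ Φ.image, g ≫ Φ.imageι = Φ.morphism ∧ IsDominant g := by
  have key : ∀ I : (ProjSpace V).IdealSheafData, I = Φ.morphism.ker →
      ∃ g : ProjSpace U ⟶ I.subscheme, g ≫ I.subschemeι = Φ.morphism ∧ IsDominant g := by
    rintro _ rfl
    exact ⟨Φ.morphism.toImage, Φ.morphism.toImage_imageι, inferInstance⟩
  exact key _ Φ.closedSubvariety_range

/-- The parametrization of a subvariety. -/
def toImage : ProjSpace U ⟶ Φ.image := Φ.exists_toImage.choose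

lemma toImage_imageι : Φ.toImage ≫ Φ.imageι = Φ.morphism := Φ.exists_toImage.choose_spec.1

instance : IsDominant Φ.toImage := Φ.exists_toImage.choose_spec.2

instance : IsIntegralHom Φ.toImage := by
  have : IsIntegralHom (Φ.toImage ≫ Φ.imageι) := by
    rw [toImage_imageι]
    infer_instance
  exact .of_comp _ Φ.imageι

instance : Surjective Φ.toImage := by
  refine ⟨Set.range_eq_univ.mp ?_⟩
  rw [← Φ.toImage.isClosedMap.isClosed_range.closure_eq, Φ.toImage.denseRange.closure_range]

instance : IrreducibleSpace Φ.image := by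
  rw [irreducibleSpace_def]
  have := (IrreducibleSpace.isIrreducible_univ (ProjSpace U)).image Φ.toImage
    Φ.toImage.continuous.continuousOn
  rwa [Set.image_univ, Φ.toImage.surjective.range_eq] at this

instance : IsReduced Φ.image := by
  have (W : (ProjSpace V).affineOpens) : IsReduced
      ((closedSubvariety (Set.range Φ.toFun)).subschemeCover.openCover.X W) := by
    change IsReduced (Spec (CommRingCat.of
      (Γ(ProjSpace V, W) ⧸ (closedSubvariety (Set.range Φ.toFun)).ideal W)))
    have h : ((closedSubvariety (Set.range Φ.toFun)).ideal W).IsRadical := by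
      rw [closedSubvariety_range, Scheme.Hom.ker_apply]
      exact (Ideal.isRadical_bot (R := Γ(ProjSpace U, Φ.morphism ⁻¹ᵁ W))).comap _
    have := (Ideal.isRadical_iff_quotient_reduced _).mp h
    infer_instance
  have (W : (closedSubvariety (Set.range Φ.toFun)).subschemeCover.openCover.I₀) : IsReduced
      ((closedSubvariety (Set.range Φ.toFun)).subschemeCover.openCover.X W) := this W
  exact IsReduced.of_openCover _ (closedSubvariety (Set.range Φ.toFun)).subschemeCover.openCover

instance : IsIntegral Φ.image := isIntegral_of_irreducibleSpace_of_isReduced _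

lemma toImage_str :
    Φ.toImage ≫ subvarietyStr (closedSubvariety (Set.range Φ.toFun)) = ProjSpace.str U := by
  rw [subvarietyStr, ← Category.assoc, toImage_imageι, morphism_str]

/-- The condition that the linear forms on `V` pull back to all the products `ℓ ^ (r - 1) * m`. -/
def IsChart (l : Module.Dual ℂ U) : Prop :=
  ∀ m : Module.Dual ℂ U, ∃ lam : Module.Dual ℂ V, ∀ u, lam (Φ.toFun u) = l u ^ (r - 1) * m u

/-- The open subset of the image where the form which pulls back to `ℓ ^ r` does not vanish. -/
theorem exists_isIso_morphismRestrict {l : Module.Dual ℂ U} (hl : Φ.IsChart l) :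
    ∃ W : Φ.image.Opens, IsIso (Φ.toImage ∣_ W) ∧
      ∀ p : ProjSpace U, linearForm l ∉ p.asHomogeneousIdeal → Φ.toImage p ∈ W := by
  obtain ⟨lam, hlam⟩ := hl l
  have hpull (m : Module.Dual ℂ U) (lam : Module.Dual ℂ V)
      (h : ∀ u, lam (Φ.toFun u) = l u ^ (r - 1) * m u) :
      Φ.pullback (linearForm lam) = linearForm l ^ (r - 1) * linearForm m :=
    coordRing_ext fun u ↦ by
      rw [evalAt_pullback, evalAt_linearForm, h, map_mul, map_pow, evalAt_linearForm,
        evalAt_linearForm]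
  have hl' : Φ.gradedHom.hom (linearForm lam) = linearForm l ^ r := by
    refine (hpull _ _ hlam).trans ?_
    rw [← pow_succ, Nat.sub_add_cancel Φ.pos]
  have hsurj : Function.Surjective (Φ.gradedHom.mapAway (linearForm lam)) := by
    intro y
    obtain ⟨n, a, ha, rfl⟩ := HomogeneousLocalization.Away.mk_surjective (grading U)
      (Φ.gradedHom.map_mem' (linearForm_mem lam)) y
    -- Let `y = a / (l ^ r) ^ n`, with `a` of degree `n * r`. Replacing each coordinate in `a` by a
    -- form that pulls back to `l ^ (r - 1)` times it gives `l ^ ((r - 1) * n * r) * a`; dividing by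
    -- `(l ^ r) ^ (n * r)` leaves `y`.
    choose lam' hlam' using fun i ↦ hl ((Module.finBasis ℂ U).coord i)
    let b : CoordRing V := MvPolynomial.aeval (fun i ↦ linearForm (lam' i)) a
    have hb : b ∈ grading V ((n * r) • 1) := by
      have := MvPolynomial.IsHomogeneous.aeval ha _ (fun i ↦ linearForm_mem (lam' i))
      simpa [b] using this
    refine ⟨.mk _ (linearForm_mem lam) (n * r) b hb, ?_⟩
    rw [DegreeScalingHom.mapAway_mk]
    apply HomogeneousLocalization.val_injective
    simp only [HomogeneousLocalization.Away.val_mk, Localization.mk_eq_mk_iff,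
      Localization.r_iff_exists]
    refine ⟨1, ?_⟩
    simp only [OneMemClass.coe_one, one_mul, hl']
    have hb' : Φ.gradedHom.hom b = (linearForm l ^ (r - 1)) ^ (n * r) * a := by
      refine coordRing_ext fun u ↦ (Φ.evalAt_pullback u b).trans ?_
      rw [evalAt_aeval_linearForm]
      have : (fun i ↦ lam' i (Φ.toFun u)) = fun i ↦
          (Module.finBasis ℂ U).repr ((l u ^ (r - 1)) • u) i := by
        ext i
        rw [hlam', map_smul, Finsupp.smul_apply, Module.Basis.coord_apply, smul_eq_mul]
      rw [this]
      refine (evalAt_smul ha _ u).trans ?_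
      rw [map_mul, map_pow, map_pow, evalAt_linearForm, one_mul, smul_eq_mul]
    rw [hb']
    obtain ⟨k, rfl⟩ : ∃ k, r = k + 1 := ⟨r - 1, (Nat.sub_add_cancel Φ.pos).symm⟩
    rw [Nat.add_sub_cancel]
    ring
  have h₁ := Φ.gradedHom.isClosedImmersion_morphismRestrict one_pos (linearForm_mem lam) hsurj
  let W := Φ.imageι ⁻¹ᵁ Proj.basicOpen (grading V) (linearForm lam)
  have h₂ : IsClosedImmersion (Φ.toImage ∣_ W ≫
      Φ.imageι ∣_ Proj.basicOpen (grading V) (linearForm lam)) := by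
    rw [← morphismRestrict_comp]
    have key : ∀ g, g = Φ.gradedHom.projMap →
        IsClosedImmersion (g ∣_ Proj.basicOpen (grading V) (linearForm lam)) := by
      rintro _ rfl
      exact h₁
    exact key _ Φ.toImage_imageι
  have h₃ : IsClosedImmersion (Φ.toImage ∣_ W) :=
    .of_comp_isClosedImmersion _ (Φ.imageι ∣_ Proj.basicOpen (grading V) (linearForm lam))
  have h₄ : Surjective (Φ.toImage ∣_ W) :=
    IsZariskiLocalAtTarget.restrict (P := @Surjective) inferInstance W
  -- A surjective closed immersion into a reduced scheme is an isomorphism.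
  refine ⟨W, isIso_of_isClosedImmersion_of_surjective _, fun p hp ↦ ?_⟩
  change (Φ.toImage ≫ Φ.imageι) p ∈ Proj.basicOpen (grading V) (linearForm lam)
  rw [toImage_imageι, Proj.mem_basicOpen]
  intro h
  have h₅ := (Φ.gradedHom.mem_projMap_apply p one_pos (linearForm_mem lam)).mp h
  rw [hl'] at h₅
  exact hp (p.isPrime.mem_of_pow_mem _ h₅)

/-- Birationality: the generic point lies in the nonempty open set where `l` does not vanish. -/
theorem isIso_stalkMap {l : Module.Dual ℂ U} (hl : Φ.IsChart l) (hl0 : l ≠ 0) :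
    IsIso (Φ.toImage.stalkMap (genericPoint (ProjSpace U))) := by
  obtain ⟨W, hW, h⟩ := Φ.exists_isIso_morphismRestrict hl
  refine isIso_stalkMap_of_isIso_morphismRestrict Φ.toImage W _ (h _ ?_)
  obtain ⟨u, hu⟩ : ∃ u, l u ≠ 0 := by
    by_contra! H
    exact hl0 (LinearMap.ext H)
  have hu0 : u ≠ 0 := by
    rintro rfl
    exact hu (map_zero l)
  refine ((genericPoint_spec (ProjSpace U)).mem_open_set_iff
    (Proj.basicOpen (grading U) (linearForm l)).isOpen).mpr ⟨ProjSpace.mk u hu0, trivial, ?_⟩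
  change linearForm l ∉ (ProjSpace.mk u hu0).asHomogeneousIdeal
  rwa [mem_mk_iff hu0 (linearForm_mem l), evalAt_linearForm]

theorem isIso_toImage (h : ∀ l, Φ.IsChart l) : IsIso Φ.toImage := by
  refine IsZariskiLocalAtTarget.of_forall_exists_morphismRestrict (P := .isomorphisms _)
    fun x ↦ ?_
  obtain ⟨p, rfl⟩ := Φ.toImage.surjective x
  obtain ⟨l, hl⟩ := exists_linearForm_notMem p
  obtain ⟨W, hW, h'⟩ := Φ.exists_isIso_morphismRestrict (h l)
  exact ⟨W, h' p hl, hW⟩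

/-- The normalization of the image of a homogeneous polynomial map which has a chart is the
projective space from which it is parametrized. -/
theorem exists_normalization_image_iso {l : Module.Dual ℂ U} (hl : Φ.IsChart l) (hl0 : l ≠ 0) :
    ∃ e : Normalization Φ.image ≅ ProjSpace U, e.hom ≫ Φ.toImage = normalizationMap Φ.image := by
  have := Φ.isIso_stalkMap hl hl0
  exact exists_normalization_iso (isCoveredByIntegrallyClosed U) Φ.toImage
    (genericPoint_of_isDominant Φ.toImage).symm

theorem isIso_toImage_of_smooth {l : Module.Dual ℂ U} (hl : Φ.IsChart l) (hl0 : l ≠ 0)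
    [Smooth (subvarietyStr (closedSubvariety (Set.range Φ.toFun)))] : IsIso Φ.toImage := by
  have := Φ.isIso_stalkMap hl hl0
  exact isIso_of_isIntegralHom_of_isIso_stalkMap
    (isCoveredByIntegrallyClosed_of_smooth (subvarietyStr (closedSubvariety (Set.range Φ.toFun))))
    Φ.toImage

/-- If a linear map `L` carries the parametrization `Ψ` to the parametrization `Φ` and both
parametrizations are isomorphisms onto their images, then `L` projects the image of `Ψ`
isomorphically onto the image of `Φ`. -/
theorem projectsIsomorphically {V' : Type*} [AddCommGroup V'] [Module ℂ V']
    [FiniteDimensional ℂ V'] (Ψ : HomogeneousMap U V' r) [IsIso Φ.toImage] [IsIso Ψ.toImage]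
    (L : V' →ₗ[ℂ] V) (hL : ∀ u, L (Ψ.toFun u) = Φ.toFun u) :
    ProjectsIsomorphically L (closedSubvariety (Set.range Ψ.toFun))
      (closedSubvariety (Set.range Φ.toFun)) := by
  refine ⟨(asIso Ψ.toImage).symm ≪≫ asIso Φ.toImage, ?_, fun x v hv hx ↦ ?_⟩
  · simp only [Iso.trans_hom, Iso.symm_hom, asIso_inv, asIso_hom, Category.assoc]
    rw [toImage_str, IsIso.inv_comp_eq, toImage_str]
  · obtain ⟨p, rfl⟩ := Ψ.toImage.surjective x
    obtain ⟨u, hu, hp⟩ := exists_specializes_mk p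
    have h₁ : Ψ.morphism p = ProjSpace.mk v hv := by
      rw [← hx, ← Ψ.toImage_imageι]
      rfl
    -- A priori `p` only specializes to `[u]`. Its image `[v]` is closed, so `p` and `[u]` have the
    -- same image, and injectivity of the parametrization identifies them.
    have h₂ : Ψ.morphism (ProjSpace.mk u hu) = ProjSpace.mk v hv :=
      eq_of_mk_specializes (h₁ ▸ hp.map Ψ.morphism.continuous)
    obtain rfl : p = ProjSpace.mk u hu := by
      apply (Ψ.toImage ≫ Ψ.imageι).injective
      rw [toImage_imageι, h₁, h₂]
    rw [morphism_mk] at h₁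
    obtain ⟨c, hc, rfl⟩ := exists_eq_smul_of_specializes (specializes_of_eq h₁)
    have hLv : L (c • Ψ.toFun u) ≠ 0 := by
      rw [map_smul, hL]
      exact smul_ne_zero hc (Φ.toFun_ne_zero hu)
    refine ⟨hLv, ?_⟩
    have h₃ : Φ.imageι (Φ.toImage (ProjSpace.mk u hu)) =
        ProjSpace.mk (Φ.toFun u) (Φ.toFun_ne_zero hu) := by
      rw [← morphism_mk, ← Φ.toImage_imageι]
      rfl
    have h₄ : (Ψ.toImage ≫ inv Ψ.toImage ≫ Φ.toImage) (ProjSpace.mk u hu) =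
        Φ.toImage (ProjSpace.mk u hu) := by
      rw [IsIso.hom_inv_id_assoc]
    have h₅ : ProjSpace.mk (L (c • Ψ.toFun u)) hLv =
        ProjSpace.mk (Φ.toFun u) (Φ.toFun_ne_zero hu) := by
      have : L (c • Ψ.toFun u) = c • Φ.toFun u := by rw [map_smul, hL]
      simp only [this]
      exact mk_smul _ _
    rw [h₅, ← h₃]
    exact congr_arg Φ.imageι h₄

end HomogeneousMap

/-! ### Symmetric forms and their diagonals -/

section Diagonal

variable {U : Type*} [AddCommGroup U] [Module ℂ U]

/-- A function is a form of degree `k` if it is the diagonal of a multilinear form. -/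
def IsForm (k : ℕ) (g : U → ℂ) : Prop :=
  ∃ Θ : MultilinearMap ℂ (fun _ : Fin k ↦ U) ℂ, ∀ u, Θ (fun _ ↦ u) = g u

lemma isForm_const (c : ℂ) : IsForm 0 (fun _ : U ↦ c) :=
  ⟨MultilinearMap.constOfIsEmpty ℂ _ c, fun _ ↦ rfl⟩

lemma IsForm.add {k : ℕ} {g h : U → ℂ} (hg : IsForm k g) (hh : IsForm k h) :
    IsForm k (fun u ↦ g u + h u) := by
  obtain ⟨Θ, hΘ⟩ := hg
  obtain ⟨Ξ, hΞ⟩ := hh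
  exact ⟨Θ + Ξ, fun u ↦ by simp [hΘ, hΞ]⟩

lemma isForm_zero (k : ℕ) : IsForm k (fun _ : U ↦ 0) := ⟨0, fun _ ↦ rfl⟩

lemma IsForm.sum {k : ℕ} {ι : Type*} (s : Finset ι) {g : ι → U → ℂ}
    (hg : ∀ i ∈ s, IsForm k (g i)) : IsForm k (fun u ↦ ∑ i ∈ s, g i u) := by
  classical
  induction s using Finset.induction_on with
  | empty => simpa using isForm_zero k
  | insert i s hi ih =>
    simp only [Finset.sum_insert hi]
    exact (hg i (Finset.mem_insert_self i s)).add
      (ih fun j hj ↦ hg j (Finset.mem_insert_of_mem hj))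

lemma IsForm.mul_left {k : ℕ} {g : U → ℂ} (hg : IsForm k g) (l : Module.Dual ℂ U) :
    IsForm (k + 1) (fun u ↦ l u * g u) := by
  obtain ⟨Θ, hΘ⟩ := hg
  refine ⟨LinearMap.uncurryLeft (l.smulRight Θ), fun u ↦ ?_⟩
  exact congr_arg (l u * ·) (hΘ u)

lemma IsForm.pow_mul {k : ℕ} {g : U → ℂ} (hg : IsForm k g) (l : Module.Dual ℂ U) (n : ℕ) :
    IsForm (k + n) (fun u ↦ l u ^ n * g u) := by
  induction n with
  | zero => simpa using hg
  | succ n ih =>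
    simp only [pow_succ', mul_assoc]
    exact ih.mul_left l

lemma isForm_dual (l : Module.Dual ℂ U) : IsForm 1 l := by
  simpa using (isForm_const 1).mul_left l

lemma IsForm.comp {U' : Type*} [AddCommGroup U'] [Module ℂ U'] {k : ℕ} {g : U → ℂ}
    (hg : IsForm k g) (f : U' →ₗ[ℂ] U) : IsForm k (fun u ↦ g (f u)) := by
  obtain ⟨Θ, hΘ⟩ := hg
  exact ⟨Θ.compLinearMap fun _ ↦ f, fun u ↦ hΘ (f u)⟩

lemma isForm_symForm {k : ℕ} (φ : SymForm U k) : IsForm k (fun u ↦ φ.1 fun _ ↦ u) :=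
  ⟨φ.1, fun _ ↦ rfl⟩

/-- A form is the diagonal of a symmetric multilinear form. -/
lemma IsForm.exists_symForm {k : ℕ} {g : U → ℂ} (hg : IsForm k g) :
    ∃ Θ : SymForm U k, ∀ u, Θ.1 (fun _ ↦ u) = g u := by
  obtain ⟨Θ, hΘ⟩ := hg
  refine ⟨⟨(k.factorial : ℂ)⁻¹ • ∑ σ : Equiv.Perm (Fin k), Θ.domDomCongr σ, fun τ w ↦ ?_⟩,
    fun u ↦ ?_⟩
  · simp only [smul_apply, sum_apply, MultilinearMap.domDomCongr_apply]
    congr 1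
    exact Fintype.sum_equiv (Equiv.mulLeft τ) _ _ fun σ ↦ rfl
  · simp [hΘ, Fintype.card_perm, Nat.factorial_ne_zero]

lemma IsForm.exists_poly [FiniteDimensional ℂ U] {k : ℕ} {g : U → ℂ} (hg : IsForm k g) :
    ∃ P ∈ ProjSpace.grading U k, ∀ u, evalAt u P = g u := by
  obtain ⟨Θ, hΘ⟩ := hg
  let b := Module.finBasis ℂ U
  refine ⟨∑ j : Fin k → Fin (Module.finrank ℂ U),
    MvPolynomial.C (Θ fun t ↦ b (j t)) * ∏ t, MvPolynomial.X (j t), ?_, fun u ↦ ?_⟩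
  · refine Submodule.sum_mem _ fun j _ ↦ ?_
    have := (MvPolynomial.isHomogeneous_C (Fin (Module.finrank ℂ U)) (Θ fun t ↦ b (j t))).mul
      (MvPolynomial.IsHomogeneous.prod Finset.univ (fun t ↦ MvPolynomial.X (R := ℂ) (j t))
        (fun _ ↦ 1) fun t _ ↦ MvPolynomial.isHomogeneous_X ℂ (j t))
    simpa using this
  · rw [← hΘ]
    conv_rhs => rw [← b.sum_repr u, MultilinearMap.map_sum]
    simp only [map_sum, map_mul, map_prod, ProjSpace.evalAt_C, ProjSpace.evalAt_X,
      MultilinearMap.map_smul_univ, smul_eq_mul, mul_comm, b]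

/-- A symmetric form whose diagonal vanishes is zero. -/
theorem symForm_eq_zero {k : ℕ} (φ : SymForm U k) (h : ∀ u, φ.1 (fun _ ↦ u) = 0) : φ = 0 := by
  classical
  induction k with
  | zero =>
    ext u
    rw [Subsingleton.elim u fun _ ↦ 0, h]
    rfl
  | succ k ih =>
    have key (x w : U) : φ.1 (Fin.cons x fun _ ↦ w) = 0 := by
      -- Polarization: `P` is `c ↦ φ(w + c x, …, w + c x)`, and by symmetry its linear coefficient
      -- is a positive multiple of `φ(x, w, …, w)`. Its vanishing gives the induction hypothesis for
      -- `ι_x φ`.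
      let P : Polynomial ℂ := ∑ s : Finset (Fin (k + 1)), Polynomial.C
        (φ.1 (s.piecewise (fun _ ↦ w) fun _ ↦ x)) * Polynomial.X ^ sᶜ.card
      have hP : P = 0 := by
        refine Polynomial.funext fun c ↦ ?_
        rw [Polynomial.eval_zero, ← h (w + c • x)]
        refine Eq.trans ?_ (φ.1.map_add_univ (fun _ ↦ w) (fun _ ↦ c • x)).symm
        rw [Polynomial.eval_finsetSum]
        refine Finset.sum_congr rfl fun s _ ↦ ?_
        have h₁ := φ.1.map_piecewise_smul (fun _ ↦ c) (s.piecewise (fun _ ↦ w) fun _ ↦ x) sᶜ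
        have h₂ : sᶜ.piecewise (fun i ↦ c • s.piecewise (fun _ ↦ w) (fun _ ↦ x) i)
            (s.piecewise (fun _ ↦ w) fun _ ↦ x) = s.piecewise (fun _ ↦ w) fun _ ↦ c • x := by
          ext j
          by_cases hj : j ∈ s <;> simp [hj]
        rw [← h₂, h₁, Finset.prod_const, smul_eq_mul]
        rw [Polynomial.eval_mul, Polynomial.eval_C, Polynomial.eval_pow, Polynomial.eval_X,
          mul_comm]
      have hval (s : Finset (Fin (k + 1))) (hs : sᶜ.card = 1) :
          φ.1 (s.piecewise (fun _ ↦ w) fun _ ↦ x) = φ.1 (Fin.cons x fun _ ↦ w) := by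
        obtain ⟨i, hi⟩ := Finset.card_eq_one.mp hs
        rw [← φ.2 (Equiv.swap 0 i) (Fin.cons x fun _ ↦ w)]
        congr 1
        ext j
        have hj : j ∈ s ↔ j ≠ i := by
          rw [← not_iff_not, ← Finset.mem_compl, hi]
          simp
        by_cases hji : j = i
        · have hjs : j ∉ s := fun h ↦ hj.mp h hji
          rw [Finset.piecewise_eq_of_notMem _ _ _ hjs, hji, Equiv.swap_apply_right, Fin.cons_zero]
        · rw [Finset.piecewise_eq_of_mem _ _ _ (hj.mpr hji)]
          have h0 : Equiv.swap 0 i j ≠ 0 := by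
            intro h
            rw [Equiv.swap_apply_eq_iff, Equiv.swap_apply_left] at h
            exact hji h
          obtain ⟨m, hm⟩ := Fin.exists_succ_eq.mpr h0
          rw [← hm, Fin.cons_succ]
      have hc := congr_arg (Polynomial.coeff · 1) hP
      simp only [P, Polynomial.finsetSum_coeff, Polynomial.coeff_C_mul, Polynomial.coeff_X_pow,
        mul_ite, mul_one, mul_zero, Polynomial.coeff_zero] at hc
      rw [← Finset.sum_filter, Finset.sum_congr rfl fun s hs ↦ hval s
        (Finset.mem_filter.mp hs).2.symm, Finset.sum_const, smul_eq_zero] at hc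
      refine hc.resolve_left ?_
      rw [← ne_eq, Finset.card_ne_zero]
      exact ⟨{0}ᶜ, by simp⟩
    ext u
    have h₁ := ih (contraction (u 0) φ) fun w ↦ key (u 0) w
    have h₂ : (contraction (u 0) φ).1 (Fin.tail u) = 0 := by
      rw [h₁]
      rfl
    have h₃ : (contraction (u 0) φ).1 (Fin.tail u) = φ.1 (Fin.cons (u 0) (Fin.tail u)) := rfl
    rw [Fin.cons_self_tail] at h₃
    rw [← h₃, h₂]
    rfl

end Diagonal

/-! ### Maps with polynomial components and their linear factorization -/

section HomogeneousMapOfForms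

variable {U V : Type*} [AddCommGroup U] [Module ℂ U]
  [AddCommGroup V] [Module ℂ V] [FiniteDimensional ℂ V] {r : ℕ}

/-- A map whose composites with the linear forms are forms of degree `r` is a homogeneous polynomial
map. -/
def HomogeneousMap.ofForms [FiniteDimensional ℂ U] (Φ : U → V) (pos : 0 < r)
    (isForm : ∀ l : Module.Dual ℂ V, IsForm r fun u ↦ l (Φ u)) (eq_zero : ∀ u, Φ u = 0 → u = 0) :
    HomogeneousMap U V r where
  toFun := Φ
  poly i := (isForm ((Module.finBasis ℂ V).coord i)).exists_poly.choose
  pos := pos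
  poly_mem i := (isForm ((Module.finBasis ℂ V).coord i)).exists_poly.choose_spec.1
  evalAt_poly i u := (isForm ((Module.finBasis ℂ V).coord i)).exists_poly.choose_spec.2 u
  eq_zero := eq_zero

/-- A homogeneous polynomial map factors linearly through the `r`-th power map. -/
lemma exists_linearMap_symPowOf (Φ : U → V)
    (isForm : ∀ l : Module.Dual ℂ V, IsForm r fun u ↦ l (Φ u))
    (h : ∀ l : Module.Dual ℂ V, (∀ u, l (Φ u) = 0) → l = 0) :
    ∃ L : SymPow U r →ₗ[ℂ] V, Function.Surjective L ∧ ∀ u, L (symPowOf r u) = Φ u := by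
  let b := Module.finBasis ℂ V
  choose Θ hΘ using fun i ↦ (isForm (b.coord i)).exists_symForm
  let L : SymPow U r →ₗ[ℂ] V := ∑ i, (Module.Dual.eval ℂ (SymForm U r) (Θ i)).smulRight (b i)
  have hL (θ : SymPow U r) : L θ = ∑ i, θ (Θ i) • b i := by
    simp [L, LinearMap.sum_apply]
  have hLu (u : U) : L (symPowOf r u) = Φ u := by
    rw [hL, ← b.sum_repr (Φ u)]
    exact Finset.sum_congr rfl fun i _ ↦ congr_arg (· • b i) (hΘ i u)
  refine ⟨L, ?_, hLu⟩
  rw [← LinearMap.range_eq_top]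
  by_contra hne
  obtain ⟨l, hl, hl'⟩ := Submodule.exists_le_ker_of_lt_top _ (lt_top_iff_ne_top.mpr hne)
  refine hl (h l fun u ↦ ?_)
  rw [← hLu]
  exact hl' ⟨_, rfl⟩

end HomogeneousMapOfForms

/-! ### The Veronese map -/

section Veronese

variable {U : Type*} [AddCommGroup U] [Module ℂ U] {r : ℕ}

lemma isForm_pow_mul_dual (l m : Module.Dual ℂ U) (hr : 0 < r) :
    IsForm r fun u ↦ l u ^ (r - 1) * m u := by
  obtain ⟨k, rfl⟩ : ∃ k, r = 1 + k := ⟨r - 1, by omega⟩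
  rw [Nat.add_sub_cancel_left]
  exact (isForm_dual m).pow_mul l k

variable [FiniteDimensional ℂ U]

/-- The `r`-th power map as a homogeneous polynomial map. -/
def powerMap (U : Type*) [AddCommGroup U] [Module ℂ U] [FiniteDimensional ℂ U] (hr : 0 < r) :
    HomogeneousMap U (SymPow U r) r :=
  .ofForms (symPowOf r) hr
    (fun l ↦ by
      obtain ⟨Θ, rfl⟩ := (Module.evalEquiv ℂ (SymForm U r)).surjective l
      exact isForm_symForm Θ)
    (fun u hu ↦ by
      refine (Module.forall_dual_apply_eq_zero_iff ℂ u).mp fun l ↦ ?_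
      obtain ⟨Θ, hΘ⟩ := (isForm_pow_mul_dual l l hr).exists_symForm
      have h := congr($hu Θ)
      change Θ.1 (fun _ ↦ u) = 0 at h
      rw [hΘ, ← pow_succ, Nat.sub_add_cancel hr] at h
      exact pow_eq_zero_iff hr.ne' |>.mp h)

lemma powerMap_isChart (hr : 0 < r) (l : Module.Dual ℂ U) : (powerMap U hr).IsChart l := by
  intro m
  obtain ⟨Θ, hΘ⟩ := (isForm_pow_mul_dual l m hr).exists_symForm
  exact ⟨Module.Dual.eval ℂ _ Θ, hΘ⟩

end Veronese

/-! ### The morphism attached to a symbol system -/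

namespace SymbolSystem

variable {W : Type*} [AddCommGroup W] [Module ℂ W] {r : ℕ} (F : SymbolSystem W r)

/-- Since `F^1 = W^*` has no base points, the order is at least `1`; this gives `0 < r`. -/
lemma baseLocus_one : F.baseLocus 1 = ∅ := by
  refine Set.eq_empty_of_forall_notMem fun p hp ↦ p.rep_nonzero ?_
  refine (Module.forall_dual_apply_eq_zero_iff ℂ _).mp fun l ↦ ?_
  obtain ⟨Θ, hΘ⟩ := (isForm_dual l).exists_symForm
  rw [← hΘ]
  exact hp Θ (F.F_one ▸ Submodule.mem_top)

variable {F} in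
lemma IsOrder.pos (hF : F.IsOrder r) : 0 < r := hF.2 F.baseLocus_one

variable {F} in
lemma eq_zero_of_baseLocus_eq_empty {k : ℕ} (hk : F.baseLocus k = ∅) {w : W}
    (h : F.iotaPow k w = 0) : w = 0 := by
  by_contra hw
  have : Projectivization.mk ℂ w hw ∈ F.baseLocus k := by
    intro φ hφ
    obtain ⟨c, hc⟩ := Projectivization.exists_smul_eq_mk_rep ℂ w hw
    rw [← hc]
    have h₁ : φ.1 (fun _ ↦ w) = 0 := congr($h ⟨φ, hφ⟩)
    have h₂ := φ.1.map_smul_univ (fun _ ↦ (c : ℂ)) (fun _ ↦ w)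
    rw [h₁, smul_zero] at h₂
    exact h₂
  rw [hk] at this
  exact this

variable {F} in
lemma IsOrder.phi_eq_zero (hF : F.IsOrder r) {u : ℂ × W} (h : F.phi u = 0) : u = 0 := by
  have hr := hF.pos
  obtain ⟨t, w⟩ := u
  simp only [phi, Prod.mk_eq_zero] at h
  obtain ⟨ht, hw, hk⟩ := h
  have ht : t = 0 := pow_eq_zero_iff hr.ne' |>.mp ht
  refine Prod.ext ht ?_
  -- For `r = 1` the index `r` does not occur in `Finset.Icc 2 r`; the top component is then the
  -- `W`-component, with coefficient `t ^ 0`.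
  rcases Nat.lt_or_ge 1 r with h1 | h1
  · refine eq_zero_of_baseLocus_eq_empty hF.1 ?_
    simpa using congr_fun hk ⟨r, Finset.mem_Icc.mpr ⟨h1, le_rfl⟩⟩
  · obtain rfl : r = 1 := le_antisymm h1 hr
    simpa using hw

variable [FiniteDimensional ℂ W]

lemma exists_dual_ambient_eq (l : Module.Dual ℂ F.ambient) :
    ∃ (a : ℂ) (m : Module.Dual ℂ W) (φ : ∀ k : Finset.Icc 2 r, F.F k),
      ∀ x : F.ambient, l x = a * x.1 + m x.2.1 + ∑ k, x.2.2 k (φ k) := by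
  classical
  let j (k : Finset.Icc 2 r) : Module.Dual ℂ (F.F k) →ₗ[ℂ] F.ambient :=
    LinearMap.inr ℂ ℂ _ ∘ₗ LinearMap.inr ℂ W _ ∘ₗ
      LinearMap.single ℂ (fun k : Finset.Icc 2 r ↦ Module.Dual ℂ (F.F k)) k
  have (k : Finset.Icc 2 r) : Module.IsReflexive ℂ (F.F k) :=
    have : Module.Free ℂ (F.F k) := Module.Free.of_divisionRing ℂ (F.F k)
    Module.IsReflexive.of_finite_of_free ℂ (F.F k)
  choose φ hφ using fun k : Finset.Icc 2 r ↦
    (Module.evalEquiv ℂ (F.F k)).surjective (l ∘ₗ j k)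
  refine ⟨l (1, 0, 0), l ∘ₗ LinearMap.inr ℂ ℂ _ ∘ₗ LinearMap.inl ℂ W _, φ, fun x ↦ ?_⟩
  have h (k) : x.2.2 k (φ k) = l (j k (x.2.2 k)) := congr($(hφ k) (x.2.2 k))
  have hx : x = x.1 • ((1, 0, 0) : F.ambient) + (0, x.2.1, 0) + ∑ k, j k (x.2.2 k) := by
    simp only [j, LinearMap.comp_apply, ← map_sum]
    simp only [LinearMap.single_apply, Finset.univ_sum_single]
    refine Prod.ext ?_ (Prod.ext ?_ ?_) <;> simp
  simp only [h, ← map_sum]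
  conv_lhs => rw [hx]
  rw [map_add, map_add, map_smul, smul_eq_mul, mul_comm]
  rfl

lemma isForm_dual_phi (hr : 0 < r) (l : Module.Dual ℂ F.ambient) : IsForm r fun u ↦ l (F.phi u) := by
  obtain ⟨a, m, φ, h⟩ := F.exists_dual_ambient_eq l
  simp only [h]
  refine (IsForm.add ?_ ?_).add (IsForm.sum _ fun k _ ↦ ?_)
  · simpa [SymbolSystem.phi, mul_comm] using
      (isForm_const a).pow_mul (LinearMap.fst ℂ ℂ W) r
  · have := (isForm_dual (m ∘ₗ LinearMap.snd ℂ ℂ W)).pow_mul (LinearMap.fst ℂ ℂ W) (r - 1)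
    rw [Nat.add_sub_cancel' hr] at this
    simpa [SymbolSystem.phi] using this
  · have := ((isForm_symForm (φ k).1).comp (LinearMap.snd ℂ ℂ W)).pow_mul
      (LinearMap.fst ℂ ℂ W) (r - k)
    rw [Nat.add_sub_cancel' (Finset.mem_Icc.mp k.2).2] at this
    exact this

/-- For fixed `w`, `l (F.phi (t, w))` is a polynomial in `t` in which the components of `l` occur
with distinct exponents, so each vanishes at `w`. A symmetric form is determined by its diagonal,
hence `l = 0`. -/
lemma eq_zero_of_dual_phi_eq_zero (hr : 0 < r) (l : Module.Dual ℂ F.ambient)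
    (hl : ∀ u, l (F.phi u) = 0) : l = 0 := by
  obtain ⟨a, m, φ, h⟩ := F.exists_dual_ambient_eq l
  have key (w : W) : a = 0 ∧ m w = 0 ∧ ∀ k, (φ k).1.1 (fun _ ↦ w) = 0 := by
    let P : Polynomial ℂ := Polynomial.C a * Polynomial.X ^ r +
      Polynomial.C (m w) * Polynomial.X ^ (r - 1) +
      ∑ k : Finset.Icc 2 r, Polynomial.C ((φ k).1.1 (fun _ ↦ w)) * Polynomial.X ^ (r - (k : ℕ))
    have hP : P = 0 := by
      refine Polynomial.funext fun t ↦ ?_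
      have := hl (t, w)
      rw [h] at this
      simp only [P, Polynomial.eval_add, Polynomial.eval_mul, Polynomial.eval_C,
        Polynomial.eval_pow, Polynomial.eval_X, Polynomial.eval_finsetSum, Polynomial.eval_zero]
      rw [← this]
      refine congr_arg₂ _ (congr_arg₂ _ rfl ?_) (Finset.sum_congr rfl fun k _ ↦ mul_comm _ _)
      exact (mul_comm _ _).trans (m.map_smul _ _).symm
    have hk (k : Finset.Icc 2 r) := Finset.mem_Icc.mp k.2
    have coeff (n : ℕ) := congr(Polynomial.coeff $hP n)
    simp only [P, Polynomial.coeff_add, Polynomial.coeff_C_mul_X_pow, Polynomial.finsetSum_coeff,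
      Polynomial.coeff_zero] at coeff
    refine ⟨?_, ?_, fun k ↦ ?_⟩
    · have := coeff r
      rwa [if_pos rfl, if_neg (by omega), Finset.sum_eq_zero fun k _ ↦ if_neg (by
        have := hk k; omega), add_zero, add_zero] at this
    · have := coeff (r - 1)
      rwa [if_neg (by omega), if_pos rfl, Finset.sum_eq_zero fun k _ ↦ if_neg (by
        have := hk k; omega), zero_add, add_zero] at this
    · have := coeff (r - k)
      rwa [if_neg (by have := hk k; omega), if_neg (by have := hk k; omega),
        Finset.sum_eq_single k (fun i _ hi ↦ if_neg fun heq ↦ hi (Subtype.ext (by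
          have := hk k; have := hk i; omega))) (by simp), if_pos rfl, zero_add, zero_add] at this
  have hφ (k) : φ k = 0 := Subtype.ext (symForm_eq_zero _ fun w ↦ (key w).2.2 k)
  refine LinearMap.ext fun x ↦ ?_
  simp [h, (key 0).1, (key x.2.1).2.1, hφ]

variable {F} in
/-- The map `φ_F` as a homogeneous polynomial map. -/
def IsOrder.phiMap (hF : F.IsOrder r) : HomogeneousMap (ℂ × W) F.ambient r :=
  .ofForms F.phi hF.pos (F.isForm_dual_phi hF.pos) fun _ ↦ hF.phi_eq_zero

-- The components in `ℂ` and `W` of `F.phi u` together form `t ^ (r - 1) • u`, so every `m` composed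
-- with them gives the required linear form.
variable {F} in
lemma IsOrder.phiMap_isChart (hF : F.IsOrder r) : hF.phiMap.IsChart (LinearMap.fst ℂ ℂ W) := by
  intro m
  refine ⟨m ∘ₗ LinearMap.prodMap LinearMap.id (LinearMap.fst ℂ W _), fun u ↦ ?_⟩
  have : (LinearMap.prodMap LinearMap.id (LinearMap.fst ℂ W _) : F.ambient →ₗ[ℂ] ℂ × W)
      (F.phi u) = u.1 ^ (r - 1) • u := by
    refine Prod.ext ?_ rfl
    change u.1 ^ r = u.1 ^ (r - 1) * u.1
    rw [← pow_succ, Nat.sub_add_cancel hF.pos]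
  exact (congr_arg m this).trans (map_smul m _ _)

end SymbolSystem

theorem propositionp {W : Type*} [AddCommGroup W] [Module ℂ W] [FiniteDimensional ℂ W] {r : ℕ}
    (F : SymbolSystem W r) (hF : F.IsOrder r) :
    (∃ _ : AlgebraicGeometry.IsIntegral F.M, ∃ e : Normalization F.M ≅ ProjSpace (ℂ × W),
      e.hom ≫ ProjSpace.str (ℂ × W) = normalizationMap F.M ≫ subvarietyStr F.idealM) ∧
    (AlgebraicGeometry.Smooth (subvarietyStr F.idealM) →
      ∃ L : SymPow (ℂ × W) r →ₗ[ℂ] F.ambient, Function.Surjective L ∧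
        ProjectsIsomorphically L (idealVeronese (ℂ × W) r) F.idealM) := by
  have hne : (LinearMap.fst ℂ ℂ W : Module.Dual ℂ (ℂ × W)) ≠ 0 := fun h ↦
    one_ne_zero (congr($h (1, 0)) : (1 : ℂ) = 0)
  refine ⟨⟨inferInstanceAs (IsIntegral hF.phiMap.image), ?_⟩, fun hsm ↦ ?_⟩
  · obtain ⟨e, he⟩ := hF.phiMap.exists_normalization_image_iso hF.phiMap_isChart hne
    exact ⟨e, (congr_arg (e.hom ≫ ·) hF.phiMap.toImage_str.symm).trans
      ((Category.assoc _ _ _).symm.trans (congr_arg (· ≫ subvarietyStr F.idealM) he))⟩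
  · obtain ⟨L, hL, hLu⟩ := exists_linearMap_symPowOf F.phi (F.isForm_dual_phi hF.pos)
      (F.eq_zero_of_dual_phi_eq_zero hF.pos)
    have : Smooth (subvarietyStr (closedSubvariety (Set.range hF.phiMap.toFun))) := hsm
    have := hF.phiMap.isIso_toImage_of_smooth hF.phiMap_isChart hne
    have := (powerMap (ℂ × W) hF.pos).isIso_toImage (powerMap_isChart hF.pos)
    exact ⟨L, hL, hF.phiMap.projectsIsomorphically (powerMap (ℂ × W) hF.pos) L hLu⟩

end
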